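/- **Model.** Packets travel on the directed path $0\to1\to\dots\to n-1$ in rounds $t=0,1,2,\dots$; a round is an injection step followed by a forwarding step, in which at most one packet may cross each link. An adversary $A$ injects in each round finitely many packets $P$, each with an injection site $i_P$ and a destination $w_P\ge i_P$. It is $(\rho,\sigma)$-bounded if for every node $v$ and all rounds $a\le b$ at most $\rho(b-a+1)+\sigma$ of the packets injected in rounds $a,\dots,b$ satisfy $i_P\le v\le w_P$. A packet leaves the network as soon as it is at its destination. **Hierarchy.** Let $n=m^\ell$ with $\ell\ge1$. For $0\le j<\ell$ the level-$j$ intervals are $I_{j,r}=[rm^{j+1},(r+1)m^{j+1})$, $0\le r<m^{\ell-1-j}$. The intermediate destinations of $I_{j,r}$ are $w_k=rm^{j+1}+km^j$, $0\le k<m$. A packet with destination $w$ at a node $i<w$ has as level the largest position $j$ in which the base-$m$ representations of $i$ and $w$ differ, and as intermediate destination $\lfloor w/m^j\rfloor m^j$. The pseudo-buffer $L_{j,k}(i)$ consists of the accepted packets at $i$ of level $j$ whose intermediate destination is the $k$-th one of the level-$j$ interval containing $i$. It is bad if it has at least two packets. Which packet a nonempty pseudo-buffer sends when it forwards is decided by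 an arbitrary priority rule. **Algorithm HPTS, round $t$.** Packets injected in rounds $t-\ell,\dots,t-1$ are accepted in round $t$ if $\ell\mid t$; until it is accepted, a packet waits at its injection site. Put $\lambda=t\bmod\ell$ and start with no active pseudo-buffer. A node is inactive if none of its pseudo-buffers is active. 1. In every level-$\lambda$ interval, with intermediate destinations $w_0<\dots<w_{m-1}$, put $i'=w_{m-1}$. For $k=m-1,\dots,0$: if some node $i<i'$ of the interval has $L_{\lambda,k}(i)$ bad, let $i_k$ be the leftmost such node, activate $L_{\lambda,k}(i)$ for $i_k\le i\le\min\{i'-1,w_k-1\}$, and put $i'=i_k$. 2. For $j=\lambda-1,\dots,0$, and for every level-$j$ interval with left endpoint $a$ and intermediate destinations $w_0<\dots<w_{m-1}$: suppose that $a$ is inactive and that an active pseudo-buffer of $a-1$ is about to send a packet with intermediate destination $a$ and final destination different from $a$ that will join $L_{j,k}(a)$, and $L_{j,k}(a)$ is nonempty (a pre-bad packet). Then activate $L_{j,k}(i)$ for all $i$ with $a\le i<w_k$ such that $a,a+1,\dots,i$ are all inactive. 3. Every nonempty active pseudo-buffer forwards one packet. **Theorem.** Let $m\ge0$, $\ell\ge1$,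 $n=m^\ell$, let $\rho\ge0$ be real with $\rho\cdot\ell\le1$, and let $\sigma\ge0$ be an integer. Then against every $(\rho,\sigma)$-bounded adversary, and for every priority rule, HPTS forwards at most one packet over each link in each round, and at all times every node holds at most $\ell\,n^{1/\ell}+\sigma+1$ packets, where packets waiting to be accepted are counted as well. -/

import Mathlib

/-! Packet forwarding on the directed path `0 → 1 → ⋯ → n - 1`, and the algorithm HPTS. -/

namespace HPTS

/-- A packet on the path with `n` nodes: its injection site and its destination. -/
@[ext] structure Packet (n : ℕ) where
  src : ℕ
  dst : ℕ
  src_le_dst : src ≤ dst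
  dst_lt : dst < n

/-- An adversary (injection pattern): the packets injected in each round `t = 0, 1, 2, …`.
Several packets with the same route may be injected in one round. -/
abbrev Adversary (n : ℕ) := ℕ → Multiset (Packet n)

/-- `N_[a,b](v)`: the number of packets injected in the rounds `a, …, b` whose path
`src, src + 1, …, dst` contains the node `v`. -/
def Adversary.crossings {n : ℕ} (A : Adversary n) (a b v : ℕ) : ℕ :=
  ∑ t ∈ Finset.Icc a b, ((A t).filter (fun P => P.src ≤ v ∧ v ≤ P.dst)).card

/-- `A` is `(ρ, σ)`-bounded: for every node `v` and every interval of rounds `[a, b]`,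
`N_[a,b](v) ≤ ρ * (b - a + 1) + σ`. -/
def Adversary.IsBounded {n : ℕ} (A : Adversary n) (ρ : ℝ) (σ : ℕ) : Prop :=
  ∀ v < n, ∀ a b : ℕ, a ≤ b → (A.crossings a b v : ℝ) ≤ ρ * ((b : ℝ) - a + 1) + σ

/-! ### The hierarchical partition (base `m`, levels `0, …, ℓ - 1`) -/

/-- The digit in position `j` of the base-`m` representation of `i`. -/
def digit (m i j : ℕ) : ℕ := i / m ^ j % m

/-- The largest position `j < ℓ` in which the base-`m` representations of `i` and `w` differ
(used for `i ≠ w`, `i, w < m ^ ℓ`). -/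
def lv (m ℓ i w : ℕ) : ℕ :=
  Nat.findGreatest (fun j => digit m i j ≠ digit m w j) (ℓ - 1)

/-- The intermediate destination `x(i, w)` of a packet at node `i` with destination `w`. -/
def interDest (m ℓ i w : ℕ) : ℕ := w / m ^ lv m ℓ i w * m ^ lv m ℓ i w

/-- The left endpoint `r * m ^ (j + 1)` of the level-`j` interval
`I_{j,r} = [r * m ^ (j + 1), (r + 1) * m ^ (j + 1))`, where `r < m ^ (ℓ - 1 - j)`. -/
def left (m j r : ℕ) : ℕ := r * m ^ (j + 1)

/-- The `k`-th intermediate destination `w_k` of the level-`j` interval `I_{j,r}`,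
that is, the left endpoint of its `k`-th subinterval of length `m ^ j`. -/
def dest (m j r k : ℕ) : ℕ := left m j r + k * m ^ j

/-- The name of the `(level, idx)`-pseudo-buffer of the node `node`. -/
@[ext] structure PB where
  level : ℕ
  idx : ℕ
  node : ℕ

/-- The contents of all nodes. -/
abbrev Config (n : ℕ) := ℕ → Multiset (Packet n)

open Classical in
/-- The contents of the pseudo-buffer `q = (j, k, i)`: the packets stored in `i` whose current
segment has level `j` and whose intermediate destination is the `k`-th one of the level-`j`
interval that contains `i`. -/
noncomputable def content {n : ℕ} (m ℓ : ℕ) (C : Config n) (q : PB) : Multiset (Packet n) :=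
  (C q.node).filter (fun P => lv m ℓ q.node P.dst = q.level ∧
    interDest m ℓ q.node P.dst = dest m q.level (q.node / m ^ (q.level + 1)) q.idx)

/-- The pseudo-buffer `q` is bad. -/
def Bad {n : ℕ} (m ℓ : ℕ) (C : Config n) (q : PB) : Prop := 2 ≤ (content m ℓ C q).card

/-- A priority rule: which packet a nonempty pseudo-buffer `q` with contents `S` sends
if it forwards in round `t`. -/
abbrev Priority (n : ℕ) :=
  ℕ → PB → (S : Multiset (Packet n)) → S ≠ 0 → {P : Packet n // P ∈ S}

open Classical in
/-- The packet that `q` sends if it is active in round `t` (none if `q` is empty). -/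
noncomputable def head {n : ℕ} (m ℓ : ℕ) (pr : Priority n) (t : ℕ) (C : Config n) (q : PB) :
    Multiset (Packet n) :=
  if h : content m ℓ C q ≠ 0 then {(pr t q (content m ℓ C q) h).1} else 0

/-- No pseudo-buffer of the node `i` is in the set `𝒜` of active pseudo-buffers. -/
def Inactive (𝒜 : Set PB) (i : ℕ) : Prop := ∀ q ∈ 𝒜, q.node ≠ i

/-! ### One round of the algorithm -/

open Classical in
/-- The loop of `FormPaths(I_{j,r}, j)` after it has treated the indices
`k = m - 1, m - 2, …, m - c`: the pseudo-buffers activated so far and the current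
value of the bound `i'`. -/
noncomputable def formPathsLoop {n : ℕ} (m ℓ : ℕ) (C : Config n) (j r : ℕ) : ℕ → Set PB × ℕ
  | 0 => (∅, dest m j r (m - 1))
  | c + 1 =>
    let 𝒜 := (formPathsLoop m ℓ C j r c).1
    let i' := (formPathsLoop m ℓ C j r c).2
    let k := m - 1 - c
    let badNodes := (Finset.Ico (left m j r) (left m j (r + 1))).filter
      (fun i => i < i' ∧ Bad m ℓ C ⟨j, k, i⟩)
    if h : badNodes.Nonempty then
      (𝒜 ∪ {q | q.level = j ∧ q.idx = k ∧ badNodes.min' h ≤ q.node ∧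
          q.node < i' ∧ q.node < dest m j r k},
        badNodes.min' h)
    else (𝒜, i')

/-- The pseudo-buffers activated by `FormPaths(I_{j,r}, j)`. -/
noncomputable def formPaths {n : ℕ} (m ℓ : ℕ) (C : Config n) (j r : ℕ) : Set PB :=
  (formPathsLoop m ℓ C j r m).1

/-- The node `a` is pre-bad at level `j` for the packet `P`, where `P` will join the
`(j, k)`-pseudo-buffer of `a`: some active pseudo-buffer of `a - 1` sends `P`, for which `a` is
the current intermediate destination but not the final one, and the `(j, k)`-pseudo-buffer of `a`,
which `P` joins, is nonempty. -/
def PreBad {n : ℕ} (m ℓ : ℕ) (pr : Priority n) (t : ℕ) (C : Config n) (𝒜 : Set PB)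
    (P : Packet n) (a j k : ℕ) : Prop :=
  (∃ q ∈ 𝒜, q.node + 1 = a ∧ P ∈ head m ℓ pr t C q ∧ interDest m ℓ q.node P.dst = a) ∧
  P.dst ≠ a ∧ lv m ℓ a P.dst = j ∧
  k < m ∧ interDest m ℓ a P.dst = dest m j (a / m ^ (j + 1)) k ∧
  1 ≤ (content m ℓ C ⟨j, k, a⟩).card

/-- `ActivatePreBad(𝒜, j)`: in every level-`j` interval `I_{j,r}` whose left endpoint `a` is
inactive and pre-bad for a packet with level-`j` intermediate destination `w_k`, activate the
`(j, k)`-pseudo-buffers from `a` up to the last node before `w_k` that can be reached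
through inactive nodes. -/
def activatePreBad {n : ℕ} (m ℓ : ℕ) (pr : Priority n) (t : ℕ) (C : Config n) (𝒜 : Set PB)
    (j : ℕ) : Set PB :=
  𝒜 ∪ {q | ∃ r < m ^ (ℓ - 1 - j), Inactive 𝒜 (left m j r) ∧
    (∃ P, PreBad m ℓ pr t C 𝒜 P (left m j r) j q.idx) ∧
    q.level = j ∧ left m j r ≤ q.node ∧ q.node < dest m j r q.idx ∧
    ∀ i, left m j r ≤ i → i ≤ q.node → Inactive 𝒜 i}

/-- The active pseudo-buffers after `FormPaths` at level `lam` in all level-`lam` intervals and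
`c` passes of `ActivatePreBad`, for the levels `lam - 1, lam - 2, …, lam - c`. -/
def activeLoop {n : ℕ} (m ℓ : ℕ) (pr : Priority n) (t : ℕ) (C : Config n) (lam : ℕ) :
    ℕ → Set PB
  | 0 => {q | ∃ r < m ^ (ℓ - 1 - lam), q ∈ formPaths m ℓ C lam r}
  | c + 1 => activatePreBad m ℓ pr t C (activeLoop m ℓ pr t C lam c) (lam - 1 - c)

/-- The set of pseudo-buffers that are active in the forwarding step of round `t`;
the level served in round `t` is `t % ℓ`. -/
def active {n : ℕ} (m ℓ : ℕ) (pr : Priority n) (t : ℕ) (C : Config n) : Set PB :=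
  activeLoop m ℓ pr t C (t % ℓ) (t % ℓ)

open Classical in
/-- The packets forwarded over the link `(i, i + 1)` in round `t`: one from every nonempty
active pseudo-buffer of `i`. -/
noncomputable def sent {n : ℕ} (m ℓ : ℕ) (pr : Priority n) (t : ℕ) (C : Config n) (i : ℕ) :
    Multiset (Packet n) :=
  ∑ j ∈ Finset.range ℓ, ∑ k ∈ Finset.range m,
    if (⟨j, k, i⟩ : PB) ∈ active m ℓ pr t C then head m ℓ pr t C ⟨j, k, i⟩ else 0

/-! ### Executions -/

/-- The state of the network: `waiting i` are the packets that were injected at `i` and are not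
yet accepted, `stored i` are the accepted packets at `i`. -/
structure State (n : ℕ) where
  waiting : Config n
  stored : Config n

/-- The number of packets held by node `i`, whether accepted or not. -/
def State.load {n : ℕ} (S : State n) (i : ℕ) : ℕ := (S.waiting i).card + (S.stored i).card

/-- The packets that the adversary injects at node `i` in round `t`; a packet whose destination
is `i` is delivered at once. -/
def arrivals {n : ℕ} (A : Adversary n) (t i : ℕ) : Multiset (Packet n) :=
  (A t).filter (fun P => P.src = i ∧ P.dst ≠ i)

/-- The injection step of round `t`. If `t` is a multiple of `ℓ`, the packets injected in the
rounds `t - ℓ, …, t - 1` are accepted. The packets injected in round `t` start to wait. -/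
def inject {n : ℕ} (ℓ : ℕ) (A : Adversary n) (t : ℕ) (S : State n) : State n :=
  if t % ℓ = 0 then
    { waiting := fun i => arrivals A t i
      stored := fun i => S.stored i + S.waiting i }
  else
    { waiting := fun i => S.waiting i + arrivals A t i
      stored := S.stored }

open Classical in
/-- The forwarding step of round `t`: every node `i` loses the packets sent by `i` and gets those
sent by `i - 1`, except that packets that reach their destination leave the network. -/
noncomputable def forward {n : ℕ} (m ℓ : ℕ) (pr : Priority n) (t : ℕ) (S : State n) : State n :=
  { waiting := S.waiting
    stored := fun i => (S.stored i - sent m ℓ pr t S.stored i) +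
      if i = 0 then 0 else (sent m ℓ pr t S.stored (i - 1)).filter (fun P => P.dst ≠ i) }

/-- The state at the beginning of round `t`, before the injection step. -/
noncomputable def start {n : ℕ} (m ℓ : ℕ) (pr : Priority n) (A : Adversary n) : ℕ → State n
  | 0 => { waiting := fun _ => 0, stored := fun _ => 0 }
  | t + 1 => forward m ℓ pr t (inject ℓ A t (start m ℓ pr A t))

/-- The state in round `t` after the injection step and before the forwarding step. Every packet
that a node holds right after a forwarding step is still there after the next injection step. -/
noncomputable def state {n : ℕ} (m ℓ : ℕ) (pr : Priority n) (A : Adversary n) (t : ℕ) : State n :=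
  inject ℓ A t (start m ℓ pr A t)

end HPTS

namespace HPTS

/-! Call every packet of a pseudo-buffer beyond the first bad, and let `upperBadness` count, for a
level j and a node v, the bad packets of level at least j whose current segment crosses v. At each
level at most m - 1 pseudo-buffers of v can be nonempty, so v stores at most ℓ(m - 1) packets plus
its `upperBadness` for j = 0 (`card_le_of_proper`). It remains to control this potential.

Consider a round that serves level λ. Above λ nothing moves. At level λ every run of `formPaths`
starts at a bad pseudo-buffer and passes one surplus packet along, so the badness over v never
rises, and drops by one if v lies on a run. Below λ, `activatePreBad` makes a pseudo-buffer forward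
whenever an arrival would create a bad packet, unless a run of level λ occupies the node. Hence
lower-level badness over v grows only if v is on a run, and then by at most one (`Grows.onTop`,
`Grows.unique`), which the drop at level λ pays for. So `upperBadness` never rises
(`upperBadness_next_le`), and it drops for j = λ if a bad packet of level λ crosses v
(`upperBadness_next_lt`).

A phase of ℓ rounds serves each level once. For each j, the potential either loses one during the
phase or is at most the one for j + 1. By induction on phases it is at most Q + (ℓ - 1 - j), where Q
is the length of a queue that receives the injected packets crossing v and serves one per phase.
Since ρℓ ≤ 1, Q and the waiting packets together are at most σ + 2, and ℓ(m - 1) + (ℓ - 1) + (σ + 2)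
= ℓm + σ + 1. -/

variable {m ℓ n : ℕ}

/-! ### Base-m arithmetic: levels and intermediate destinations -/

theorem div_pow_succ (m i j : ℕ) : i / m ^ (j + 1) = i / m ^ j / m := by
  rw [pow_succ, Nat.div_div_eq_div_mul]

/-- Once the quotients by powers of m agree they agree for all higher powers, so the level is the
last exponent at which they differ. Quotients, unlike digits, respect the order of nodes. -/
theorem lv_eq {i w h : ℕ} (hh : h < ℓ) (h1 : i / m ^ (h + 1) = w / m ^ (h + 1))
    (h2 : i / m ^ h ≠ w / m ^ h) : lv m ℓ i w = h := by
  have key : ∀ j, h < j → i / m ^ j = w / m ^ j := by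
    intro j hj
    obtain ⟨d, rfl⟩ := Nat.exists_eq_add_of_le (Nat.succ_le_of_lt hj)
    rw [pow_add, ← Nat.div_div_eq_div_mul, ← Nat.div_div_eq_div_mul]
    exact congrArg (· / m ^ d) h1
  unfold lv
  rw [Nat.findGreatest_eq_iff]
  refine ⟨by omega, fun _ hd => h2 ?_, fun j hj _ hd => hd ?_⟩
  · rw [div_pow_succ, div_pow_succ] at h1
    rw [← Nat.div_add_mod (i / m ^ h) m, ← Nat.div_add_mod (w / m ^ h) m, h1]
    unfold digit at hd
    rw [hd]
  · unfold digit
    rw [key j hj]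

theorem lv_spec {i w : ℕ} (hiw : i < w) (hw : w < m ^ ℓ) :
    lv m ℓ i w < ℓ ∧ i / m ^ (lv m ℓ i w + 1) = w / m ^ (lv m ℓ i w + 1) ∧
      i / m ^ lv m ℓ i w < w / m ^ lv m ℓ i w := by
  classical
  have hex : ∃ h, i / m ^ h = w / m ^ h :=
    ⟨ℓ, by rw [Nat.div_eq_of_lt hw, Nat.div_eq_of_lt (hiw.trans hw)]⟩
  have hspec := Nat.find_spec hex
  have hmin := fun k => Nat.find_min hex (m := k)
  have hle : Nat.find hex ≤ ℓ :=
    Nat.find_min' hex (by rw [Nat.div_eq_of_lt hw, Nat.div_eq_of_lt (hiw.trans hw)])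
  obtain ⟨h, hh⟩ : ∃ h, Nat.find hex = h + 1 := by
    refine Nat.exists_eq_succ_of_ne_zero fun h0 => ?_
    rw [h0] at hspec
    simp at hspec
    omega
  rw [hh] at hspec hmin hle
  have hne := hmin h (by omega)
  rw [lv_eq (by omega) hspec hne]
  exact ⟨by omega, hspec, lt_of_le_of_ne (Nat.div_le_div_right hiw.le) hne⟩

theorem left_le (m j u : ℕ) : left m j (u / m ^ (j + 1)) ≤ u := Nat.div_mul_le_self _ _

theorem lt_left_succ (hm : 0 < m) (j u : ℕ) : u < left m j (u / m ^ (j + 1) + 1) := by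
  unfold left
  rw [mul_comm]
  exact Nat.lt_mul_div_succ u (pow_pos hm _)

theorem left_succ (m j r : ℕ) : left m j (r + 1) = left m j r + m * m ^ j := by
  unfold left
  ring

theorem div_eq_of_mem {j r u : ℕ} (h1 : left m j r ≤ u) (h2 : u < left m j (r + 1)) :
    u / m ^ (j + 1) = r := by
  unfold left at *
  exact Nat.div_eq_of_lt_le h1 h2

theorem dest_mono (m j r : ℕ) {k k' : ℕ} (h : k ≤ k') : dest m j r k ≤ dest m j r k' := by
  unfold dest
  gcongr

theorem dest_lt_left_succ (hm : 0 < m) (j r : ℕ) {k : ℕ} (hk : k < m) :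
    dest m j r k < left m j (r + 1) := by
  rw [left_succ]
  unfold dest
  have := (Nat.mul_lt_mul_right (pow_pos hm j)).2 hk
  omega

theorem pow_dvd_dest (m j r k : ℕ) : m ^ j ∣ dest m j r k := by
  unfold dest left
  exact dvd_add (dvd_mul_of_dvd_right (pow_dvd_pow m (Nat.le_succ j)) _) (dvd_mul_left _ _)

theorem dest_injective (hm : 0 < m) {j r k k' : ℕ} (h : dest m j r k = dest m j r k') :
    k = k' := by
  unfold dest at h
  exact Nat.eq_of_mul_eq_mul_right (pow_pos hm j) (by omega)

theorem left_div_of_dvd {j u : ℕ} (h : m ^ (j + 1) ∣ u) : left m j (u / m ^ (j + 1)) = u :=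
  Nat.div_mul_cancel h

/-- The only multiple of `m ^ (j + 1)` in a level-`j` interval is its left endpoint. -/
theorem eq_left_of_dvd {j u v : ℕ} (h : m ^ (j + 1) ∣ u) (h1 : left m j (v / m ^ (j + 1)) ≤ u)
    (h2 : u ≤ v) : u = left m j (v / m ^ (j + 1)) := by
  refine le_antisymm ?_ h1
  rw [← left_div_of_dvd h]
  exact Nat.mul_le_mul_right _ (Nat.div_le_div_right h2)

theorem interDest_eq_dest {i w : ℕ} (hiw : i < w) (hw : w < m ^ ℓ) :
    interDest m ℓ i w = dest m (lv m ℓ i w) (i / m ^ (lv m ℓ i w + 1)) (digit m w (lv m ℓ i w)) := by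
  obtain ⟨-, h1, -⟩ := lv_spec hiw hw
  unfold interDest dest left digit
  rw [h1, div_pow_succ, pow_succ]
  conv_lhs => rw [← Nat.div_add_mod (w / m ^ lv m ℓ i w) m]
  ring

theorem lt_interDest (hm : 0 < m) {i w : ℕ} (hiw : i < w) (hw : w < m ^ ℓ) :
    i < interDest m ℓ i w := by
  obtain ⟨-, -, h2⟩ := lv_spec hiw hw
  exact (Nat.div_lt_iff_lt_mul (pow_pos hm _)).1 h2

theorem interDest_le (m ℓ i w : ℕ) : interDest m ℓ i w ≤ w := Nat.div_mul_le_self _ _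

theorem lv_succ_of_lt (hm : 0 < m) {i w : ℕ} (hiw : i < w) (hw : w < m ^ ℓ)
    (h : i + 1 < interDest m ℓ i w) :
    lv m ℓ (i + 1) w = lv m ℓ i w ∧ (i + 1) / m ^ (lv m ℓ i w + 1) = i / m ^ (lv m ℓ i w + 1) := by
  obtain ⟨h0, h1, -⟩ := lv_spec hiw hw
  have h3 : (i + 1) / m ^ (lv m ℓ i w + 1) = i / m ^ (lv m ℓ i w + 1) := by
    refine le_antisymm ?_ (Nat.div_le_div_right (Nat.le_succ i))
    rw [h1]
    exact Nat.div_le_div_right hiw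
  refine ⟨lv_eq h0 (h3.trans h1) (ne_of_lt ?_), h3⟩
  exact (Nat.div_lt_iff_lt_mul (pow_pos hm _)).2 h

/-- At the intermediate destination the quotients of node and destination by m to the old level
agree, hence so do all higher ones. -/
theorem lv_succ_of_eq (hm : 0 < m) {i w : ℕ} (hiw : i + 1 < w) (hw : w < m ^ ℓ)
    (h : interDest m ℓ i w = i + 1) : lv m ℓ (i + 1) w < lv m ℓ i w := by
  obtain ⟨-, -, h2⟩ := lv_spec hiw hw
  by_contra! hle
  refine absurd h2 (not_lt.2 (le_of_eq ?_))
  obtain ⟨d, hd⟩ := Nat.exists_eq_add_of_le hle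
  rw [hd, pow_add, ← Nat.div_div_eq_div_mul, ← Nat.div_div_eq_div_mul]
  refine congrArg (· / m ^ d) ?_
  rw [← h]
  exact (Nat.mul_div_cancel _ (pow_pos hm _)).symm

theorem pow_dvd_interDest (m ℓ i w : ℕ) : m ^ lv m ℓ i w ∣ interDest m ℓ i w := dvd_mul_left _ _

/-- The packet `P`, when at the node of `q`, belongs to the pseudo-buffer `q`. -/
def Belongs (m ℓ : ℕ) (q : PB) (P : Packet n) : Prop :=
  lv m ℓ q.node P.dst = q.level ∧
    interDest m ℓ q.node P.dst = dest m q.level (q.node / m ^ (q.level + 1)) q.idx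

/-- Makes the pseudo-buffer a function of packet and node, so that sums over pseudo-buffers count
the fibres of one map. -/
theorem belongs_iff (hm : 0 < m) (hn : n = m ^ ℓ) {q : PB} {P : Packet n} (h : q.node < P.dst) :
    Belongs m ℓ q P ↔ (lv m ℓ q.node P.dst, digit m P.dst (lv m ℓ q.node P.dst)) =
      (q.level, q.idx) := by
  unfold Belongs
  rw [Prod.mk.injEq]
  refine and_congr_right fun h1 => ?_
  rw [interDest_eq_dest h (hn ▸ P.dst_lt), h1]
  exact ⟨dest_injective hm, fun h => h ▸ rfl⟩

theorem digit_lt (hm : 0 < m) (i j : ℕ) : digit m i j < m := Nat.mod_lt _ hm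

/-! ### The segments built by `formPaths` -/

/-- Pass c treats the index m - 1 - c. If it finds no bad node, the bound stays put and the last
clause describes an empty segment, so later arguments need no case distinction. -/
theorem formPathsLoop_succ (C : Config n) (j r c : ℕ) :
    ((formPathsLoop m ℓ C j r c).2 ≤ left m j (r + 1)) →
    left m j r ≤ (formPathsLoop m ℓ C j r c).2 →
    left m j r ≤ (formPathsLoop m ℓ C j r (c + 1)).2 ∧
    (formPathsLoop m ℓ C j r (c + 1)).2 ≤ (formPathsLoop m ℓ C j r c).2 ∧
    ((formPathsLoop m ℓ C j r (c + 1)).2 < (formPathsLoop m ℓ C j r c).2 →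
      Bad m ℓ C ⟨j, m - 1 - c, (formPathsLoop m ℓ C j r (c + 1)).2⟩) ∧
    (∀ u, left m j r ≤ u → u < (formPathsLoop m ℓ C j r (c + 1)).2 →
      ¬ Bad m ℓ C ⟨j, m - 1 - c, u⟩) ∧
    ∀ q, q ∈ (formPathsLoop m ℓ C j r (c + 1)).1 ↔ q ∈ (formPathsLoop m ℓ C j r c).1 ∨
      (q.level = j ∧ q.idx = m - 1 - c ∧ (formPathsLoop m ℓ C j r (c + 1)).2 ≤ q.node ∧
        q.node < (formPathsLoop m ℓ C j r c).2 ∧ q.node < dest m j r (m - 1 - c)) := by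
  classical
  intro hle hge
  set s := (Finset.Ico (left m j r) (left m j (r + 1))).filter
    (fun i => i < (formPathsLoop m ℓ C j r c).2 ∧ Bad m ℓ C ⟨j, m - 1 - c, i⟩) with hs
  have hmem : ∀ i, i ∈ s ↔ (left m j r ≤ i ∧ i < left m j (r + 1)) ∧
      i < (formPathsLoop m ℓ C j r c).2 ∧ Bad m ℓ C ⟨j, m - 1 - c, i⟩ := by
    intro i
    rw [hs, Finset.mem_filter, Finset.mem_Ico]
  by_cases h : s.Nonempty
  · have e : formPathsLoop m ℓ C j r (c + 1) = ((formPathsLoop m ℓ C j r c).1 ∪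
        {q | q.level = j ∧ q.idx = m - 1 - c ∧ s.min' h ≤ q.node ∧
          q.node < (formPathsLoop m ℓ C j r c).2 ∧ q.node < dest m j r (m - 1 - c)},
        s.min' h) := by
      rw [formPathsLoop]
      convert dif_pos h
    rw [e]
    have hmin := (hmem _).1 (s.min'_mem h)
    refine ⟨hmin.1.1, hmin.2.1.le, fun _ => hmin.2.2, fun u hu hu' hb => ?_, fun q => Iff.rfl⟩
    exact absurd (s.min'_le u ((hmem u).2 ⟨⟨hu, by omega⟩, by omega, hb⟩)) (not_le.2 hu')
  · have e : formPathsLoop m ℓ C j r (c + 1) = formPathsLoop m ℓ C j r c := by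
      rw [formPathsLoop]
      convert dif_neg h
    rw [e]
    refine ⟨hge, le_rfl, fun h => absurd h (lt_irrefl _), fun u hu hu' hb => ?_, fun q => ?_⟩
    · exact h ⟨u, (hmem u).2 ⟨⟨hu, by omega⟩, hu', hb⟩⟩
    · refine ⟨Or.inl, fun h => h.resolve_right ?_⟩
      rintro ⟨-, -, h1, h2, -⟩
      omega

/-- The output of `FormPaths`: a partition of an interval into segments `[E k, E (k + 1))`, in
which the pseudo-buffers of index `k` are activated. -/
theorem formPaths_spec (hm : 0 < m) (ℓ : ℕ) (C : Config n) (j r : ℕ) :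
    ∃ E : ℕ → ℕ, E m = dest m j r (m - 1) ∧
      (∀ k < m, left m j r ≤ E k ∧ E k ≤ E (k + 1) ∧
        (E k < E (k + 1) → Bad m ℓ C ⟨j, k, E k⟩) ∧
        ∀ u, left m j r ≤ u → u < E k → ¬ Bad m ℓ C ⟨j, k, u⟩) ∧
      ∀ q, q ∈ formPaths m ℓ C j r ↔ q.level = j ∧ q.idx < m ∧ E q.idx ≤ q.node ∧
        q.node < E (q.idx + 1) ∧ q.node < dest m j r q.idx := by
  have hb : ∀ c, left m j r ≤ (formPathsLoop m ℓ C j r c).2 ∧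
      (formPathsLoop m ℓ C j r c).2 ≤ left m j (r + 1) := by
    intro c
    induction c with
    | zero =>
      refine ⟨Nat.le_add_right _ _, (dest_lt_left_succ hm j r ?_).le⟩
      omega
    | succ c ih =>
      have := formPathsLoop_succ C j r c ih.2 ih.1
      exact ⟨this.1, this.2.1.trans ih.2⟩
  have hstep := fun c => formPathsLoop_succ C j r c (hb c).2 (hb c).1
  -- E k is the bound i' after the indices m - 1, …, k have been treated, that is, after m - k
  -- passes.
  refine ⟨fun k => (formPathsLoop m ℓ C j r (m - k)).2, ?_, fun k hk => ?_, fun q => ?_⟩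
  · simp [formPathsLoop]
  · have := hstep (m - (k + 1))
    rw [show m - (k + 1) + 1 = m - k by omega, show m - 1 - (m - (k + 1)) = k by omega] at this
    exact ⟨this.1, this.2.1, this.2.2.1, this.2.2.2.1⟩
  · have hgen : ∀ c ≤ m, q ∈ (formPathsLoop m ℓ C j r c).1 ↔ q.level = j ∧ q.idx < m ∧
        m - c ≤ q.idx ∧ (formPathsLoop m ℓ C j r (m - q.idx)).2 ≤ q.node ∧
        q.node < (formPathsLoop m ℓ C j r (m - (q.idx + 1))).2 ∧ q.node < dest m j r q.idx := by
      intro c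
      induction c with
      | zero =>
        intro _
        refine iff_of_false (Set.notMem_empty q) ?_
        rintro ⟨-, h1, h2, -⟩
        omega
      | succ c ih =>
        intro hc
        rw [(hstep c).2.2.2.2 q, ih (by omega)]
        constructor
        · rintro (⟨h1, h2, h3, h4⟩ | ⟨h1, h2, h3, h4, h5⟩)
          · exact ⟨h1, h2, by omega, h4⟩
          · refine ⟨h1, by omega, by omega, ?_, ?_, h2 ▸ h5⟩
            · rwa [show m - q.idx = c + 1 by omega]
            · rwa [show m - (q.idx + 1) = c by omega]
        · rintro ⟨h1, h2, h3, h4, h5, h6⟩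
          by_cases hq : m - c ≤ q.idx
          · exact Or.inl ⟨h1, h2, hq, h4, h5, h6⟩
          · have hi : q.idx = m - 1 - c := by omega
            refine Or.inr ⟨h1, hi, ?_, ?_, hi ▸ h6⟩
            · rwa [show m - q.idx = c + 1 by omega] at h4
            · rwa [show m - (q.idx + 1) = c by omega] at h5
    have := hgen m le_rfl
    unfold formPaths
    rw [this]
    simp

theorem exists_segment {E : ℕ → ℕ} {k d x : ℕ} (h1 : E k ≤ x) (h2 : x < E d) (hkd : k ≤ d) :
    ∃ k', k ≤ k' ∧ k' < d ∧ E k' ≤ x ∧ x < E (k' + 1) := by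
  induction d, hkd using Nat.le_induction with
  | base => omega
  | succ d hd ih =>
    by_cases h : x < E d
    · obtain ⟨k', h3, h4, h5⟩ := ih h
      exact ⟨k', h3, by omega, h5⟩
    · exact ⟨d, hd, by omega, by omega, h2⟩

theorem monotone_of_step {E : ℕ → ℕ} (hE : ∀ k < m, E k ≤ E (k + 1)) {k d : ℕ} (hkd : k ≤ d)
    (hd : d ≤ m) : E k ≤ E d := by
  induction d, hkd using Nat.le_induction with
  | base => exact le_rfl
  | succ d _ ih => exact (ih (by omega)).trans (hE d (by omega))

section FormPaths

variable {C : Config n} {j r : ℕ}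

theorem mem_formPaths (hm : 0 < m) {q : PB} (h : q ∈ formPaths m ℓ C j r) :
    q.level = j ∧ q.idx < m ∧ left m j r ≤ q.node ∧ q.node < dest m j r q.idx := by
  obtain ⟨E, -, h2, h3⟩ := formPaths_spec hm ℓ C j r
  obtain ⟨h4, h5, h6, -, h7⟩ := (h3 q).1 h
  exact ⟨h4, h5, (h2 _ h5).1.trans h6, h7⟩

theorem formPaths_unique (hm : 0 < m) {q q' : PB} (h : q ∈ formPaths m ℓ C j r)
    (h' : q' ∈ formPaths m ℓ C j r) (hn : q.node = q'.node) : q = q' := by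
  obtain ⟨E, -, h2, h3⟩ := formPaths_spec hm ℓ C j r
  obtain ⟨a1, a2, a3, a4, -⟩ := (h3 q).1 h
  obtain ⟨b1, b2, b3, b4, -⟩ := (h3 q').1 h'
  have hmono : ∀ k < m, E k ≤ E (k + 1) := fun k hk => (h2 k hk).2.1
  refine PB.ext (a1.trans b1.symm) ?_ hn
  rcases lt_trichotomy q.idx q'.idx with hlt | heq | hlt
  · have := monotone_of_step hmono (Nat.succ_le_of_lt hlt) b2.le
    simp only [Nat.succ_eq_add_one] at this
    omega
  · exact heq
  · have := monotone_of_step hmono (Nat.succ_le_of_lt hlt) a2.le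
    simp only [Nat.succ_eq_add_one] at this
    omega

/-- The nodes activated by `FormPaths` form runs that end at multiples of `m ^ j` only. -/
theorem formPaths_succ (hm : 0 < m) {q : PB} (h : q ∈ formPaths m ℓ C j r)
    (hd : ¬ m ^ j ∣ q.node + 1) : ∃ q' ∈ formPaths m ℓ C j r, q'.node = q.node + 1 := by
  obtain ⟨E, h1, h2, h3⟩ := formPaths_spec hm ℓ C j r
  obtain ⟨a1, a2, a3, a4, a5⟩ := (h3 q).1 h
  have hmono : ∀ k < m, E k ≤ E (k + 1) := fun k hk => (h2 k hk).2.1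
  -- Intermediate destinations are multiples of m ^ j, so the next node is none of them and still
  -- lies before the destination of index `q.idx` and before E m.
  have hne : ∀ k, q.node + 1 ≠ dest m j r k := fun k hk => hd (hk ▸ pow_dvd_dest m j r k)
  have h4 := monotone_of_step hmono (Nat.succ_le_of_lt a2) le_rfl
  have h5 := hne (m - 1)
  simp only [Nat.succ_eq_add_one] at h4
  obtain ⟨k', b1, b2, b3, b4⟩ := exists_segment (E := E) (k := q.idx) (d := m)
    (x := q.node + 1) (by omega) (by omega) a2.le
  refine ⟨⟨j, k', q.node + 1⟩, (h3 _).2 ⟨rfl, b2, b3, b4, ?_⟩, rfl⟩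
  have := dest_mono m j r b1
  have := hne q.idx
  change q.node + 1 < dest m j r k'
  omega

/-- `FormPaths` activates every node that has a bad packet to its left whose intermediate
destination lies to its right. -/
theorem exists_mem_formPaths (hm : 0 < m) {k u v : ℕ} (hk : k < m) (hu : left m j r ≤ u)
    (huv : u ≤ v) (hv : v < dest m j r k) (hb : Bad m ℓ C ⟨j, k, u⟩) :
    ∃ q ∈ formPaths m ℓ C j r, q.node = v := by
  obtain ⟨E, h1, h2, h3⟩ := formPaths_spec hm ℓ C j r
  have h4 : E k ≤ u := by
    by_contra! h
    exact (h2 k hk).2.2.2 u hu h hb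
  have h5 := dest_mono m j r (Nat.le_sub_one_of_lt hk)
  obtain ⟨k', b1, b2, b3, b4⟩ := exists_segment (E := E) (k := k) (d := m)
    (x := v) (by omega) (by omega) hk.le
  exact ⟨⟨j, k', v⟩, (h3 _).2 ⟨rfl, b2, b3, b4, hv.trans_le (dest_mono m j r b1)⟩, rfl⟩

end FormPaths

/-! ### Active pseudo-buffers: at most one per node -/

theorem eq_of_mem_of_card_le_one {α : Type*} {s : Multiset α} (hs : s.card ≤ 1) {a b : α}
    (ha : a ∈ s) (hb : b ∈ s) : a = b := by
  obtain ⟨t, rfl⟩ := Multiset.exists_cons_of_mem ha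
  rw [Multiset.card_cons] at hs
  obtain rfl : t = 0 := Multiset.card_eq_zero.1 (by omega)
  exact (Multiset.mem_singleton.1 hb).symm

section Active

variable {pr : Priority n} {t : ℕ} {C : Config n}

theorem mem_activeLoop_zero {lam : ℕ} {q : PB} : q ∈ activeLoop m ℓ pr t C lam 0 ↔
    ∃ r < m ^ (ℓ - 1 - lam), q ∈ formPaths m ℓ C lam r := Iff.rfl

theorem mem_activeLoop_succ {lam c : ℕ} {q : PB} : q ∈ activeLoop m ℓ pr t C lam (c + 1) ↔
    q ∈ activeLoop m ℓ pr t C lam c ∨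
    ∃ r < m ^ (ℓ - 1 - (lam - 1 - c)),
      Inactive (activeLoop m ℓ pr t C lam c) (left m (lam - 1 - c) r) ∧
      (∃ P, PreBad m ℓ pr t C (activeLoop m ℓ pr t C lam c) P (left m (lam - 1 - c) r)
        (lam - 1 - c) q.idx) ∧
      q.level = lam - 1 - c ∧ left m (lam - 1 - c) r ≤ q.node ∧
      q.node < dest m (lam - 1 - c) r q.idx ∧
      ∀ i, left m (lam - 1 - c) r ≤ i → i ≤ q.node →
        Inactive (activeLoop m ℓ pr t C lam c) i := Iff.rfl

theorem level_of_mem_activeLoop (hm : 0 < m) {lam c : ℕ} (hc : c ≤ lam) {q : PB}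
    (h : q ∈ activeLoop m ℓ pr t C lam c) : lam - c ≤ q.level ∧ q.level ≤ lam := by
  induction c with
  | zero =>
    obtain ⟨r, -, h⟩ := mem_activeLoop_zero.1 h
    have := (mem_formPaths hm h).1
    omega
  | succ c ih =>
    rcases mem_activeLoop_succ.1 h with h | ⟨r, -, -, -, h, -⟩
    · have := ih (by omega) h
      omega
    · omega

/-- Each pass adds pseudo-buffers of its own level only, so every stage of the loop can be read off
a later one by a bound on the level. -/
theorem mem_activeLoop_iff (hm : 0 < m) {lam c d : ℕ} (hcd : c ≤ d) (hd : d ≤ lam) {q : PB} :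
    q ∈ activeLoop m ℓ pr t C lam c ↔
      q ∈ activeLoop m ℓ pr t C lam d ∧ lam - c ≤ q.level := by
  induction d, hcd using Nat.le_induction with
  | base => exact ⟨fun h => ⟨h, (level_of_mem_activeLoop hm hd h).1⟩, And.left⟩
  | succ d hcd ih =>
    rw [ih (by omega), mem_activeLoop_succ]
    constructor
    · rintro ⟨h1, h2⟩
      exact ⟨Or.inl h1, h2⟩
    · rintro ⟨h1 | ⟨r, -, -, -, h1, -⟩, h2⟩
      · exact ⟨h1, h2⟩
      · omega

/-- The active pseudo-buffers of level greater than `h`. -/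
def above (m ℓ : ℕ) (pr : Priority n) (t : ℕ) (C : Config n) (h : ℕ) : Set PB :=
  {q | q ∈ active m ℓ pr t C ∧ h < q.level}

theorem activeLoop_eq_above (hm : 0 < m) {h : ℕ} (hh : h < t % ℓ) :
    activeLoop m ℓ pr t C (t % ℓ) (t % ℓ - 1 - h) = above m ℓ pr t C h := by
  ext q
  rw [mem_activeLoop_iff hm (d := t % ℓ) (by omega) le_rfl]
  unfold above active
  simp only [Set.mem_ofPred_eq]
  refine and_congr_right fun _ => ?_
  omega

theorem level_le (hm : 0 < m) {q : PB} (h : q ∈ active m ℓ pr t C) : q.level ≤ t % ℓ :=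
  (level_of_mem_activeLoop hm le_rfl h).2

theorem mem_active_top (hm : 0 < m) {q : PB} (hq : q.level = t % ℓ) :
    q ∈ active m ℓ pr t C ↔
      ∃ r < m ^ (ℓ - 1 - t % ℓ), q ∈ formPaths m ℓ C (t % ℓ) r := by
  rw [← mem_activeLoop_zero (t := t) (pr := pr),
    mem_activeLoop_iff hm (Nat.zero_le (t % ℓ)) le_rfl]
  unfold active
  simp [hq]

/-- Eliminates the loop: what the pass for a level sees is `above` that level in the final active
set. -/
theorem mem_active_lower (hm : 0 < m) {q : PB} (hq : q.level < t % ℓ) :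
    q ∈ active m ℓ pr t C ↔ ∃ r < m ^ (ℓ - 1 - q.level),
      Inactive (above m ℓ pr t C q.level) (left m q.level r) ∧
      (∃ P, PreBad m ℓ pr t C (above m ℓ pr t C q.level) P (left m q.level r) q.level q.idx) ∧
      left m q.level r ≤ q.node ∧ q.node < dest m q.level r q.idx ∧
      ∀ i, left m q.level r ≤ i → i ≤ q.node → Inactive (above m ℓ pr t C q.level) i := by
  have h1 : q ∈ active m ℓ pr t C ↔
      q ∈ activeLoop m ℓ pr t C (t % ℓ) (t % ℓ - 1 - q.level + 1) := by
    rw [mem_activeLoop_iff hm (d := t % ℓ) (by omega) le_rfl]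
    unfold active
    refine ⟨fun h => ⟨h, by omega⟩, And.left⟩
  have h2 : t % ℓ - 1 - (t % ℓ - 1 - q.level) = q.level := by omega
  rw [h1, mem_activeLoop_succ, h2, activeLoop_eq_above hm hq]
  constructor
  · rintro (h | ⟨r, hr, ha, hb, -, hc⟩)
    · exact absurd h.2 (lt_irrefl _)
    · exact ⟨r, hr, ha, hb, hc⟩
  · rintro ⟨r, hr, ha, hb, hc⟩
    exact Or.inr ⟨r, hr, ha, hb, rfl, hc⟩

theorem mem_active_bounds (hm : 0 < m) {q : PB} (h : q ∈ active m ℓ pr t C) :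
    q.idx < m ∧ q.node < dest m q.level (q.node / m ^ (q.level + 1)) q.idx := by
  have key : ∀ r, q.idx < m → left m q.level r ≤ q.node → q.node < dest m q.level r q.idx →
      q.idx < m ∧ q.node < dest m q.level (q.node / m ^ (q.level + 1)) q.idx := by
    intro r h1 h2 h3
    rw [div_eq_of_mem h2 (h3.trans (dest_lt_left_succ hm _ _ h1))]
    exact ⟨h1, h3⟩
  rcases (level_le hm h).lt_or_eq with hq | hq
  · obtain ⟨r, -, -, ⟨P, -, -, -, h1, -⟩, h2, h3, -⟩ := (mem_active_lower hm hq).1 h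
    exact key r h1 h2 h3
  · obtain ⟨r, -, h1⟩ := (mem_active_top hm hq).1 h
    obtain ⟨-, h1, h2, h3⟩ := mem_formPaths hm h1
    exact key r h1 (hq ▸ h2) (hq ▸ h3)

theorem mem_active_lower' (hm : 0 < m) {q : PB} (h : q ∈ active m ℓ pr t C)
    (hq : q.level < t % ℓ) :
    (∃ P, PreBad m ℓ pr t C (above m ℓ pr t C q.level) P
      (left m q.level (q.node / m ^ (q.level + 1))) q.level q.idx) ∧
    ∀ i, left m q.level (q.node / m ^ (q.level + 1)) ≤ i → i ≤ q.node →
      Inactive (above m ℓ pr t C q.level) i := by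
  obtain ⟨r, -, -, h1, h2, h3, h4⟩ := (mem_active_lower hm hq).1 h
  obtain ⟨P, -, -, -, hk, -⟩ := id h1
  rw [div_eq_of_mem h2 (h3.trans (dest_lt_left_succ hm _ _ hk))]
  exact ⟨h1, h4⟩

theorem mem_active_top' (hm : 0 < m) {q : PB} (h : q ∈ active m ℓ pr t C)
    (hq : q.level = t % ℓ) :
    q ∈ formPaths m ℓ C (t % ℓ) (q.node / m ^ (t % ℓ + 1)) := by
  obtain ⟨r, -, h⟩ := (mem_active_top hm hq).1 h
  obtain ⟨-, h1, h2, h3⟩ := mem_formPaths hm h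
  rwa [div_eq_of_mem h2 (h3.trans (dest_lt_left_succ hm _ _ h1))]

theorem card_head_le (q : PB) : (head m ℓ pr t C q).card ≤ 1 := by
  unfold head
  split_ifs <;> simp

theorem mem_content {q : PB} {P : Packet n} :
    P ∈ content m ℓ C q ↔ P ∈ C q.node ∧ Belongs m ℓ q P := by
  unfold content
  rw [Multiset.mem_filter]
  rfl

theorem mem_content_of_mem_head {q : PB} {P : Packet n} (h : P ∈ head m ℓ pr t C q) :
    P ∈ content m ℓ C q := by
  unfold head at h
  split_ifs at h with h0
  · rw [Multiset.mem_singleton] at h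
    exact h ▸ (pr t q _ h0).2
  · simp at h

theorem eq_of_mem_head {q : PB} {P Q : Packet n} (h : P ∈ head m ℓ pr t C q)
    (h' : Q ∈ head m ℓ pr t C q) : P = Q :=
  eq_of_mem_of_card_le_one (card_head_le q) h h'

/-- A lower level activates only nodes that are inactive above it, so two levels never meet. On the
served level the segments are disjoint. On a lower level both pseudo-buffers stem from packets sent
by the node before the left endpoint; by induction on the node it sends just one packet, which fixes
the index. -/
theorem active_unique (hm : 0 < m) {q q' : PB} (h : q ∈ active m ℓ pr t C)
    (h' : q' ∈ active m ℓ pr t C) (hn : q.node = q'.node) : q = q' := by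
  obtain ⟨i, hi⟩ : ∃ i, q.node = i := ⟨_, rfl⟩
  induction i using Nat.strong_induction_on generalizing q q' with
  | _ i ih =>
  have hlt : ∀ {p p' : PB}, p ∈ active m ℓ pr t C → p' ∈ active m ℓ pr t C →
      p.node = p'.node → ¬ p.level < p'.level := by
    intro p p' hp hp' hnode hl
    have := (mem_active_lower' hm hp (hl.trans_le (level_le hm hp'))).2 p.node (left_le _ _ _) le_rfl
    exact this p' ⟨hp', hl⟩ hnode.symm
  have hlev : q.level = q'.level :=
    le_antisymm (not_lt.1 (hlt h' h hn.symm)) (not_lt.1 (hlt h h' hn))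
  rcases (level_le hm h).lt_or_eq with hq | hq
  · obtain ⟨⟨P, ⟨p, hp, hpn, hPp, -⟩, -, -, -, hPd, -⟩, -⟩ := mem_active_lower' hm h hq
    obtain ⟨⟨P', ⟨p', hp', hpn', hPp', -⟩, -, -, -, hPd', -⟩, -⟩ :=
      mem_active_lower' hm h' (hlev ▸ hq)
    have hl := left_le m q.level q.node
    rw [← hlev, ← hn] at hpn' hPd'
    have hpp : p = p' := ih p.node (by omega) hp.1 hp'.1 (by omega) rfl
    subst hpp
    obtain rfl := eq_of_mem_head hPp hPp'
    exact PB.ext hlev (dest_injective hm (hPd.symm.trans hPd')) hn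
  · have h1 := mem_active_top' hm h hq
    have h2 := mem_active_top' hm h' (hlev ▸ hq)
    rw [← hn] at h2
    exact formPaths_unique hm h1 h2 hn

theorem sent_eq_head (hm : 0 < m) (hℓ : 0 < ℓ) {q : PB} (h : q ∈ active m ℓ pr t C) :
    sent m ℓ pr t C q.node = head m ℓ pr t C q := by
  have hlev : q.level < ℓ := (level_le hm h).trans_lt (Nat.mod_lt _ hℓ)
  unfold sent
  rw [Finset.sum_eq_single q.level, Finset.sum_eq_single q.idx]
  · exact if_pos h
  · intro k _ hk
    exact if_neg fun h' => hk (congrArg PB.idx (active_unique hm h' h rfl : (⟨q.level, k, q.node⟩ : PB) = q))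
  · intro hk
    exact absurd (Finset.mem_range.2 (mem_active_bounds hm h).1) hk
  · intro j _ hj
    refine Finset.sum_eq_zero fun k _ => ?_
    exact if_neg fun h' => hj (congrArg PB.level (active_unique hm h' h rfl : (⟨j, k, q.node⟩ : PB) = q))
  · intro hk
    exact absurd (Finset.mem_range.2 hlev) hk

theorem sent_eq_zero {i : ℕ} (h : Inactive (active m ℓ pr t C) i) :
    sent m ℓ pr t C i = 0 := by
  unfold sent
  refine Finset.sum_eq_zero fun j _ => Finset.sum_eq_zero fun k _ => ?_
  exact if_neg fun h' => h _ h' rfl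

theorem card_sent_le (hm : 0 < m) (hℓ : 0 < ℓ) (i : ℕ) : (sent m ℓ pr t C i).card ≤ 1 := by
  by_cases h : Inactive (active m ℓ pr t C) i
  · rw [sent_eq_zero h]
    simp
  · unfold Inactive at h
    push Not at h
    obtain ⟨q, hq, rfl⟩ := h
    rw [sent_eq_head hm hℓ hq]
    exact card_head_le q

theorem exists_of_mem_sent (hm : 0 < m) (hℓ : 0 < ℓ) {i : ℕ} {P : Packet n}
    (hP : P ∈ sent m ℓ pr t C i) :
    ∃ q ∈ active m ℓ pr t C, q.node = i ∧ P ∈ head m ℓ pr t C q := by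
  by_cases h : Inactive (active m ℓ pr t C) i
  · rw [sent_eq_zero h] at hP
    simp at hP
  · unfold Inactive at h
    push Not at h
    obtain ⟨q, hq, rfl⟩ := h
    rw [sent_eq_head hm hℓ hq] at hP
    exact ⟨q, hq, rfl, hP⟩

end Active

/-! ### Local effect of one forwarding step -/

/-- Every packet is stored strictly before its destination. -/
def Proper (C : Config n) : Prop := ∀ i, ∀ P ∈ C i, i < P.dst

open Classical in
/-- The packets that join the node `i` in the forwarding step. -/
noncomputable def arriving (m ℓ : ℕ) (pr : Priority n) (t : ℕ) (C : Config n) (i : ℕ) :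
    Multiset (Packet n) :=
  if i = 0 then 0 else (sent m ℓ pr t C (i - 1)).filter (fun P => P.dst ≠ i)

open Classical in
/-- The contents of the nodes after the forwarding step. -/
noncomputable def next (m ℓ : ℕ) (pr : Priority n) (t : ℕ) (C : Config n) : Config n :=
  fun i => (C i - sent m ℓ pr t C i) + arriving m ℓ pr t C i

/-- The number of bad packets of the pseudo-buffer `q`. -/
noncomputable def excess (m ℓ : ℕ) (C : Config n) (q : PB) : ℕ := (content m ℓ C q).card - 1

open Classical in
/-- The number of packets that join the pseudo-buffer `q` in the forwarding step. -/
noncomputable def inflow (m ℓ : ℕ) (pr : Priority n) (t : ℕ) (C : Config n) (q : PB) : ℕ :=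
  ((arriving m ℓ pr t C q.node).filter (Belongs m ℓ q)).card

/-- The pseudo-buffer `q` is nonempty and inactive, and receives a packet. -/
def Grows (m ℓ : ℕ) (pr : Priority n) (t : ℕ) (C : Config n) (q : PB) : Prop :=
  q ∉ active m ℓ pr t C ∧ 1 ≤ (content m ℓ C q).card ∧ 1 ≤ inflow m ℓ pr t C q

/-- The node `u` is activated by `FormPaths`. -/
def OnTop (m ℓ : ℕ) (pr : Priority n) (t : ℕ) (C : Config n) (u : ℕ) : Prop :=
  ∃ q ∈ active m ℓ pr t C, q.level = t % ℓ ∧ q.node = u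

section Round

variable {pr : Priority n} {t : ℕ} {C : Config n}

theorem content_eq_filter {q : PB} [DecidablePred (Belongs (n := n) m ℓ q)] :
    content m ℓ C q = (C q.node).filter (Belongs m ℓ q) := by
  unfold content
  exact Multiset.filter_congr fun _ _ => Iff.rfl

theorem card_arriving_le (hm : 0 < m) (hℓ : 0 < ℓ) (i : ℕ) :
    (arriving m ℓ pr t C i).card ≤ 1 := by
  unfold arriving
  split_ifs
  · simp
  · exact (Multiset.card_le_card (Multiset.filter_le _ _)).trans (card_sent_le hm hℓ _)

theorem inflow_le (hm : 0 < m) (hℓ : 0 < ℓ) (q : PB) : inflow m ℓ pr t C q ≤ 1 := by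
  classical
  unfold inflow
  exact (Multiset.card_le_card (Multiset.filter_le _ _)).trans (card_arriving_le hm hℓ _)

theorem card_content_next_le (hm : 0 < m) (hℓ : 0 < ℓ) (q : PB) [Decidable (q ∈ active m ℓ pr t C)] :
    (content m ℓ (next m ℓ pr t C) q).card ≤
      (content m ℓ C q).card - (if q ∈ active m ℓ pr t C then 1 else 0) +
        inflow m ℓ pr t C q := by
  classical
  rw [content_eq_filter, content_eq_filter]
  unfold next inflow
  rw [Multiset.filter_add, Multiset.card_add]
  refine Nat.add_le_add_right ?_ _
  have hle : ((C q.node - sent m ℓ pr t C q.node).filter (Belongs m ℓ q)).card ≤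
      ((C q.node).filter (Belongs m ℓ q)).card :=
    Multiset.card_le_card (Multiset.filter_le_filter _ tsub_le_self)
  split_ifs with hq
  -- An active empty pseudo-buffer sends nothing; truncated subtraction covers this case.
  · by_cases h0 : content m ℓ C q = 0
    · rw [← content_eq_filter, h0] at hle ⊢
      simpa using hle
    · obtain ⟨P, hP, hPc⟩ : ∃ P, head m ℓ pr t C q = {P} ∧ P ∈ content m ℓ C q := by
        unfold head
        rw [dif_pos h0]
        exact ⟨_, rfl, (pr t q _ h0).2⟩
      rw [sent_eq_head hm hℓ hq, hP]
      rw [mem_content] at hPc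
      have h1 := tsub_add_cancel_of_le (Multiset.singleton_le.2 hPc.1)
      conv_rhs => rw [← h1]
      rw [Multiset.filter_add, Multiset.card_add, Multiset.filter_singleton, if_pos hPc.2]
      simp
  · exact hle

/-- A packet entering an empty pseudo-buffer is not bad, and an active nonempty one sends a packet
for the at most one it receives. -/
theorem excess_next_le (hm : 0 < m) (hℓ : 0 < ℓ) (q : PB) [Decidable (Grows m ℓ pr t C q)] :
    excess m ℓ (next m ℓ pr t C) q ≤
      excess m ℓ C q + if Grows m ℓ pr t C q then 1 else 0 := by
  classical
  have h1 := card_content_next_le (pr := pr) (t := t) (C := C) hm hℓ q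
  have h2 := inflow_le (pr := pr) (t := t) (C := C) hm hℓ q
  unfold excess
  by_cases h3 : q ∈ active m ℓ pr t C
  · rw [if_pos h3] at h1
    omega
  rw [if_neg h3] at h1
  split_ifs with h4
  · omega
  · by_cases h5 : 1 ≤ (content m ℓ C q).card
    · have : ¬ 1 ≤ inflow m ℓ pr t C q := fun h6 => h4 ⟨h3, h5, h6⟩
      omega
    · omega

theorem excess_next_lt (hm : 0 < m) (hℓ : 0 < ℓ) {q : PB} (hq : q ∈ active m ℓ pr t C)
    (hb : Bad m ℓ C q) (hi : ¬ 1 ≤ inflow m ℓ pr t C q) :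
    excess m ℓ (next m ℓ pr t C) q + 1 ≤ excess m ℓ C q := by
  classical
  have h1 := card_content_next_le (pr := pr) (t := t) (C := C) hm hℓ q
  rw [if_pos hq] at h1
  unfold Bad at hb
  unfold excess
  omega

theorem Belongs.idx_lt (hm : 0 < m) (hn : n = m ^ ℓ) {q : PB} {P : Packet n}
    (hb : Belongs m ℓ q P) (h : q.node < P.dst) :
    q.idx < m ∧ q.node < dest m q.level (q.node / m ^ (q.level + 1)) q.idx := by
  refine ⟨?_, hb.2 ▸ lt_interDest hm h (hn ▸ P.dst_lt)⟩
  have := (belongs_iff hm hn h).1 hb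
  rw [Prod.mk.injEq] at this
  rw [← this.2]
  exact digit_lt hm _ _

theorem Belongs.unique (hm : 0 < m) {q q' : PB} {P : Packet n} (h : Belongs m ℓ q P)
    (h' : Belongs m ℓ q' P) (hnode : q.node = q'.node) : q = q' := by
  obtain ⟨j, k, i⟩ := q
  obtain ⟨j', k', i'⟩ := q'
  simp only at hnode
  subst hnode
  obtain ⟨h1, h2⟩ := h
  obtain ⟨h1', h2'⟩ := h'
  simp only at h1 h2 h1' h2'
  obtain rfl := h1.symm.trans h1'
  rw [dest_injective hm (h2.symm.trans h2')]

/-- The dichotomy is whether the move brings the packet to its intermediate destination. If not,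
level, index and interval persist; if so, the level drops. -/
theorem exists_of_inflow (hm : 0 < m) (hℓ : 0 < ℓ) (hn : n = m ^ ℓ) (hC : Proper C) {q : PB}
    (hi : 1 ≤ inflow m ℓ pr t C q) :
    ∃ P p, P ∈ arriving m ℓ pr t C q.node ∧ p ∈ active m ℓ pr t C ∧ p.node + 1 = q.node ∧
      P ∈ head m ℓ pr t C p ∧
      q.node < P.dst ∧ Belongs m ℓ q P ∧ Belongs m ℓ p P ∧
      ((p.level = q.level ∧ p.idx = q.idx ∧
          p.node / m ^ (q.level + 1) = q.node / m ^ (q.level + 1)) ∨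
        (q.level < p.level ∧ interDest m ℓ p.node P.dst = q.node ∧ m ^ p.level ∣ q.node)) := by
  classical
  unfold inflow at hi
  obtain ⟨P, hP⟩ := Multiset.card_pos_iff_exists_mem.1 hi
  rw [Multiset.mem_filter] at hP
  obtain ⟨hP, hqP⟩ := hP
  have hP' := hP
  unfold arriving at hP
  split_ifs at hP with h0
  · simp at hP
  rw [Multiset.mem_filter] at hP
  obtain ⟨p, hp, hpn, hPp⟩ := exists_of_mem_sent hm hℓ hP.1
  have hc := mem_content.1 (mem_content_of_mem_head hPp)
  have hpd := hC _ _ hc.1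
  have hnode : p.node + 1 = q.node := by omega
  have hqd : q.node < P.dst := by
    have := hP.2
    omega
  have hPn : P.dst < m ^ ℓ := hn ▸ P.dst_lt
  refine ⟨P, p, hP', hp, hnode, hPp, hqd, hqP, hc.2, ?_⟩
  rcases (Nat.succ_le_of_lt (lt_interDest hm hpd hPn)).lt_or_eq with h | h
  · have h1 := lv_succ_of_lt hm hpd hPn h
    have h2 : interDest m ℓ (p.node + 1) P.dst = interDest m ℓ p.node P.dst := by
      unfold interDest
      rw [h1.1]
    rw [hnode] at h1 h2
    have hl : p.level = q.level := by rw [← hc.2.1, ← h1.1, hqP.1]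
    rw [hc.2.1, hl] at h1
    refine Or.inl ⟨hl, ?_, h1.2.symm⟩
    rw [hqP.2, hc.2.2, hl, h1.2] at h2
    exact (dest_injective hm h2).symm
  · have h1 := lv_succ_of_eq hm (hnode ▸ hqd) hPn h.symm
    rw [hnode, hqP.1, hc.2.1] at h1
    refine Or.inr ⟨h1, h.symm.trans hnode, ?_⟩
    rw [← hnode, ← hc.2.1]
    have := pow_dvd_interDest m ℓ p.node P.dst
    rwa [← h] at this

/-- Runs of the served level λ end only at multiples of m ^ λ, and beyond its left endpoint an
interval of lower level contains none. -/
theorem OnTop.extend (hm : 0 < m) {j u v x : ℕ} (hj : j < t % ℓ)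
    (hu : left m j (v / m ^ (j + 1)) ≤ u) (htop : OnTop m ℓ pr t C u) (hux : u ≤ x) (hxv : x ≤ v) :
    OnTop m ℓ pr t C x := by
  induction x, hux using Nat.le_induction with
  | base => exact htop
  | succ x hx ih =>
    obtain ⟨q, hq, hql, hqn⟩ := ih (by omega)
    obtain ⟨r, hr, hqr⟩ := (mem_active_top hm hql).1 hq
    have hd : ¬ m ^ (t % ℓ) ∣ q.node + 1 := by
      intro hd
      have := eq_left_of_dvd ((pow_dvd_pow m (Nat.succ_le_of_lt hj)).trans hd)
        (v := v) (j := j) (by omega) (by omega)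
      omega
    obtain ⟨q', hq', hqn'⟩ := formPaths_succ hm hqr hd
    have hl := (mem_formPaths hm hq').1
    exact ⟨q', (mem_active_top hm hl).2 ⟨r, hr, hq'⟩, hl, by omega⟩

theorem active_pred (hm : 0 < m) {q : PB} (h : q ∈ active m ℓ pr t C) (hq : q.level < t % ℓ)
    (hl : left m q.level (q.node / m ^ (q.level + 1)) < q.node) :
    (⟨q.level, q.idx, q.node - 1⟩ : PB) ∈ active m ℓ pr t C ∧
      (q.node - 1) / m ^ (q.level + 1) = q.node / m ^ (q.level + 1) := by
  obtain ⟨r, hr, h1, h2, h3, h4, h5⟩ := (mem_active_lower hm hq).1 h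
  obtain ⟨P, -, -, -, hk, -⟩ := id h2
  have hlt := h4.trans (dest_lt_left_succ hm _ _ hk)
  have hr' := div_eq_of_mem h3 hlt
  rw [hr'] at hl ⊢
  refine ⟨(mem_active_lower (q := ⟨q.level, q.idx, q.node - 1⟩) hm hq).2
    ⟨r, hr, h1, h2, ?_, ?_, ?_⟩, div_eq_of_mem ?_ ?_⟩
  · change left m q.level r ≤ q.node - 1
    omega
  · change q.node - 1 < dest m q.level r q.idx
    omega
  · intro i hi hi'
    change i ≤ q.node - 1 at hi'
    exact h5 i hi (by omega)
  · omega
  · omega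

/-- The arrival would have made `activatePreBad` start or prolong a path through q, so a
higher-level pseudo-buffer q' must occupy the node. If q' were below the served level, its own path
would conflict with the sender p. -/
theorem Grows.onTop (hm : 0 < m) (hℓ : 0 < ℓ) (hn : n = m ^ ℓ) (hC : Proper C) {q : PB}
    (hq : q.level < t % ℓ) (hqn : q.node < n) (hg : Grows m ℓ pr t C q) :
    OnTop m ℓ pr t C q.node := by
  obtain ⟨hna, hc, hi⟩ := hg
  obtain ⟨P, p, -, hp, hpn, hPp, hqd, hqP, hpP, h⟩ := exists_of_inflow hm hℓ hn hC hi
  obtain ⟨hk, hqdest⟩ := hqP.idx_lt hm hn hqd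
  have hleft := left_le m q.level q.node
  have hpred : p.node = q.node - 1 := by omega
  by_contra htop
  rcases h with ⟨hl, hidx, hdiv⟩ | ⟨hl, hint, hdvd⟩
  · obtain ⟨r, hr, h1, h2, h3, h4, h5⟩ := (mem_active_lower hm (hl ▸ hq)).1 hp
    rw [hl, hidx] at h2
    rw [hl] at hr h1 h3 h5
    rw [hl, hidx] at h4
    have hr' : q.node / m ^ (q.level + 1) = r := by
      rw [← hdiv]
      exact div_eq_of_mem h3 (h4.trans (dest_lt_left_succ hm _ _ hk))
    rw [hr'] at hqdest
    have hex : ¬ Inactive (above m ℓ pr t C q.level) q.node := by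
      refine fun hina => hna ((mem_active_lower hm hq).2
        ⟨r, hr, h1, h2, by omega, hqdest, fun i hi hi' => ?_⟩)
      rcases hi'.lt_or_eq with h | rfl
      · exact h5 i hi (by omega)
      · exact hina
    unfold Inactive at hex
    push Not at hex
    obtain ⟨q', ⟨hq', hql'⟩, hqn'⟩ := hex
    have hlt : q'.level < t % ℓ :=
      lt_of_le_of_ne (level_le hm hq') fun h => htop ⟨q', hq', h, hqn'⟩
    -- The path of q' cannot start here: the node would be the left endpoint of the level-`q.level`
    -- interval, which already contains p to its left. So the path of q' also uses the node of p,
    -- which was inactive above `q.level`.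
    have hne : left m q'.level (q'.node / m ^ (q'.level + 1)) ≠ q'.node := by
      intro heq
      have hd : m ^ (q'.level + 1) ∣ q'.node := heq ▸ dvd_mul_left _ _
      have := eq_left_of_dvd (v := q.node) (j := q.level)
        (u := q.node) (hqn' ▸ (pow_dvd_pow m (by omega)).trans hd) hleft le_rfl
      rw [hr'] at this
      omega
    have hpr := (active_pred hm hq' hlt (lt_of_le_of_ne (left_le _ _ _) hne)).1
    exact h5 p.node h3 le_rfl _ ⟨hpr, hql'⟩ (by simp only; omega)
  · have hdvd' : m ^ (q.level + 1) ∣ q.node := (pow_dvd_pow m (Nat.succ_le_of_lt hl)).trans hdvd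
    have hleft' := left_div_of_dvd hdvd'
    have hex : ¬ Inactive (above m ℓ pr t C q.level) q.node := by
      refine fun hina => hna ((mem_active_lower hm hq).2 ⟨q.node / m ^ (q.level + 1), ?_, ?_⟩)
      · have : t % ℓ < ℓ := Nat.mod_lt _ hℓ
        rw [Nat.div_lt_iff_lt_mul (pow_pos hm _), ← pow_add,
          show ℓ - 1 - q.level + (q.level + 1) = ℓ by omega, ← hn]
        exact hqn
      · rw [hleft']
        refine ⟨hina, ⟨P, ⟨p, ⟨hp, hl⟩, hpn, hPp, hint⟩, hqd.ne', hqP.1, hk, hqP.2, hc⟩, le_rfl,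
          hqdest, fun i h1 h2 => ?_⟩
        rwa [le_antisymm h2 h1]
    unfold Inactive at hex
    push Not at hex
    obtain ⟨q', ⟨hq', hql'⟩, hqn'⟩ := hex
    have hlt : q'.level < t % ℓ :=
      lt_of_le_of_ne (level_le hm hq') fun h => htop ⟨q', hq', h, hqn'⟩
    -- Either the path of q' comes through p, and then P would have to travel beyond this node; or
    -- it starts here because of P itself, and then P would join level `q'.level` rather than
    -- `q.level`.
    rcases (left_le m q'.level q'.node).lt_or_eq with h | h
    · obtain ⟨h1, h2⟩ := active_pred hm hq' hlt h
      obtain rfl := active_unique hm hp h1 (by simp only; omega)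
      have h3 := hpP.2
      rw [hint] at h3
      simp only at h3
      rw [h2] at h3
      have := (mem_active_bounds hm hq').2
      omega
    · obtain ⟨⟨P', ⟨p', hp', hpn', hPp', -⟩, -, hlv, -⟩, -⟩ := mem_active_lower' hm hq' hlt
      rw [h] at hpn' hlv
      obtain rfl := active_unique hm hp hp'.1 (by omega)
      obtain rfl := eq_of_mem_head hPp hPp'
      rw [hqn', hqP.1] at hlv
      omega

/-- If two such nodes differed, the run through the left one would reach the predecessor of the
right one. The packet arriving there would leave the served level λ, making that node a multiple of
m ^ λ inside a lower-level interval. At a single node only one packet arrives. -/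
theorem Grows.unique (hm : 0 < m) (hℓ : 0 < ℓ) (hn : n = m ^ ℓ) (hC : Proper C) {q q' : PB} {v : ℕ}
    (hv : v < n) (hq : q.level < t % ℓ) (hq' : q'.level < t % ℓ)
    (hl : left m q.level (v / m ^ (q.level + 1)) ≤ q.node) (hqv : q.node ≤ v)
    (hl' : left m q'.level (v / m ^ (q'.level + 1)) ≤ q'.node) (hqv' : q'.node ≤ v)
    (hg : Grows m ℓ pr t C q) (hg' : Grows m ℓ pr t C q') : q = q' := by
  have key : ∀ {q q' : PB}, q.level < t % ℓ → q'.level < t % ℓ →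
      left m q.level (v / m ^ (q.level + 1)) ≤ q.node → q'.node ≤ v →
      Grows m ℓ pr t C q → Grows m ℓ pr t C q' → ¬ q.node < q'.node := by
    intro q q' hq hq' hl hqv' hg hg' hlt
    obtain ⟨P, p, -, hp, hpn, -, -, -, -, h⟩ := exists_of_inflow hm hℓ hn hC hg'.2.2
    have htop := (hg.onTop hm hℓ hn hC hq (by omega)).extend hm hq hl (x := p.node)
      (by omega) (by omega)
    obtain ⟨p', hp', hpl, hpn'⟩ := htop
    obtain rfl := active_unique hm hp hp' hpn'.symm
    rcases h with h | ⟨-, -, hd⟩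
    · omega
    · rw [hpl] at hd
      have := eq_left_of_dvd ((pow_dvd_pow m (Nat.succ_le_of_lt hq)).trans hd)
        (v := v) (by omega) hqv'
      omega
  have hnode : q.node = q'.node :=
    le_antisymm (not_lt.1 (key hq' hq hl' hqv hg' hg)) (not_lt.1 (key hq hq' hl hqv' hg hg'))
  obtain ⟨P, -, hP, -, -, -, -, hPq, -⟩ := exists_of_inflow hm hℓ hn hC hg.2.2
  obtain ⟨P', -, hP', -, -, -, -, hPq', -⟩ := exists_of_inflow hm hℓ hn hC hg'.2.2
  rw [← hnode] at hP'
  obtain rfl := eq_of_mem_of_card_le_one (card_arriving_le hm hℓ _) hP hP'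
  exact hPq.unique hm hPq' hnode

/-! ### Badness over a node in one round -/

/-- The number of bad packets at the nodes `u ≤ v` of the level-`j` interval of `v` that are in
`(j, k)`-pseudo-buffers. -/
noncomputable def badness (m ℓ : ℕ) (C : Config n) (j k v : ℕ) : ℕ :=
  ∑ u ∈ Finset.Icc (left m j (v / m ^ (j + 1))) v, excess m ℓ C ⟨j, k, u⟩

/-- The indices of the intermediate destinations of the level-`j` interval of `v` after `v`. -/
def indices (m j v : ℕ) : Finset ℕ :=
  (Finset.range m).filter (fun k => v < dest m j (v / m ^ (j + 1)) k)

/-- The number of bad packets whose current segment has level `j` and crosses `v`. -/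
noncomputable def levelBadness (m ℓ : ℕ) (C : Config n) (j v : ℕ) : ℕ :=
  ∑ k ∈ indices m j v, badness m ℓ C j k v

/-- The number of bad packets whose current segment has level at least `j` and crosses `v`. -/
noncomputable def upperBadness (m ℓ : ℕ) (C : Config n) (j v : ℕ) : ℕ :=
  ∑ i ∈ Finset.Ico j ℓ, levelBadness m ℓ C i v

theorem mem_indices {j k v : ℕ} :
    k ∈ indices m j v ↔ k < m ∧ v < dest m j (v / m ^ (j + 1)) k := by
  unfold indices
  rw [Finset.mem_filter, Finset.mem_range]

/-- Nothing is active above the served level, and the level of a packet never rises. -/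
theorem levelBadness_next_of_lt (hm : 0 < m) (hℓ : 0 < ℓ) (hn : n = m ^ ℓ) (hC : Proper C)
    {j : ℕ} (hj : t % ℓ < j) (v : ℕ) :
    levelBadness m ℓ (next m ℓ pr t C) j v ≤ levelBadness m ℓ C j v := by
  classical
  refine Finset.sum_le_sum fun k _ => Finset.sum_le_sum fun u _ => ?_
  refine (excess_next_le (pr := pr) (t := t) hm hℓ _).trans (le_of_eq ?_)
  rw [if_neg, add_zero]
  rintro ⟨-, -, hi⟩
  obtain ⟨P, p, -, hp, -, -, -, -, -, h⟩ := exists_of_inflow hm hℓ hn hC hi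
  have := level_le hm hp
  simp only at h
  omega

theorem badness_next_top (hm : 0 < m) (hℓ : 0 < ℓ) (hn : n = m ^ ℓ) (hC : Proper C)
    {k v : ℕ} (hv : v < n) (hk : k ∈ indices m (t % ℓ) v) :
    badness m ℓ (next m ℓ pr t C) (t % ℓ) k v ≤ badness m ℓ C (t % ℓ) k v ∧
      ((⟨t % ℓ, k, v⟩ : PB) ∈ active m ℓ pr t C →
        badness m ℓ (next m ℓ pr t C) (t % ℓ) k v + 1 ≤ badness m ℓ C (t % ℓ) k v) := by
  classical
  obtain ⟨hk, hvk⟩ := mem_indices.1 hk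
  have htl : t % ℓ < ℓ := Nat.mod_lt _ hℓ
  obtain ⟨r, hr⟩ : ∃ r, v / m ^ (t % ℓ + 1) = r := ⟨_, rfl⟩
  have hlv := left_le m (t % ℓ) v
  have hvl := lt_left_succ hm (t % ℓ) v
  unfold badness
  rw [hr] at hvk hlv hvl ⊢
  have hrlt : r < m ^ (ℓ - 1 - t % ℓ) := by
    rw [← hr, Nat.div_lt_iff_lt_mul (pow_pos hm _), ← pow_add,
      show ℓ - 1 - t % ℓ + (t % ℓ + 1) = ℓ by omega, ← hn]
    exact hv
  obtain ⟨E, -, hE, hmem⟩ := formPaths_spec hm ℓ C (t % ℓ) r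
  obtain ⟨hE1, hE2, hE3, -⟩ := hE k hk
  have hdiv : ∀ u, left m (t % ℓ) r ≤ u → u ≤ v → u / m ^ (t % ℓ + 1) = r :=
    fun u h1 h2 => div_eq_of_mem h1 (by omega)
  have hact : ∀ u, left m (t % ℓ) r ≤ u → u ≤ v →
      ((⟨t % ℓ, k, u⟩ : PB) ∈ active m ℓ pr t C ↔ E k ≤ u ∧ u < E (k + 1)) := by
    intro u hu hu'
    constructor
    · intro h
      have := mem_active_top' hm h rfl
      simp only at this
      rw [hdiv u hu hu', hmem] at this
      exact ⟨this.2.2.1, this.2.2.2.1⟩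
    · rintro ⟨h1, h2⟩
      exact (mem_active_top hm rfl).2
        ⟨r, hrlt, (hmem _).2 ⟨rfl, hk, h1, h2, lt_of_le_of_lt hu' hvk⟩⟩
  have hin : ∀ u, left m (t % ℓ) r ≤ u → u ≤ v → 1 ≤ inflow m ℓ pr t C ⟨t % ℓ, k, u⟩ →
      E k < u ∧ u ≤ E (k + 1) := by
    intro u hu hu' hi
    obtain ⟨P, p, -, hp, hpn, -, -, -, -, h⟩ := exists_of_inflow hm hℓ hn hC hi
    have hple := level_le hm hp
    simp only at h hpn
    rcases h with ⟨h1, h2, h3⟩ | ⟨h, -⟩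
    · rw [hdiv u hu hu'] at h3
      have h4 := left_le m (t % ℓ) p.node
      rw [h3] at h4
      have hpe : p = ⟨t % ℓ, k, p.node⟩ := PB.ext h1 h2 rfl
      rw [hpe] at hp
      have := (hact _ h4 (by omega)).1 hp
      omega
    · omega
  -- On the segment [E k, E (k + 1)) the first node loses a bad packet, as it receives nothing of
  -- index k; only E (k + 1) can gain one. After summation over u ≤ v the gain is counted only if
  -- the loss is.
  have hpt : ∀ u ∈ Finset.Icc (left m (t % ℓ) r) v,
      excess m ℓ (next m ℓ pr t C) ⟨t % ℓ, k, u⟩ +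
          (if u = E k then (if E k < E (k + 1) then 1 else 0) else 0) ≤
        excess m ℓ C ⟨t % ℓ, k, u⟩ +
          (if u = E (k + 1) then (if E k < E (k + 1) then 1 else 0) else 0) := by
    intro u hu
    rw [Finset.mem_Icc] at hu
    have h1 := excess_next_le (pr := pr) (t := t) (C := C) hm hℓ ⟨t % ℓ, k, u⟩
    have h2 := hact u hu.1 hu.2
    have h3 := hin u hu.1 hu.2
    by_cases hlt : E k < E (k + 1)
    · rw [if_pos hlt]
      by_cases hu1 : u = E k
      · have := excess_next_lt hm hℓ (h2.2 (by omega)) (hu1 ▸ hE3 hlt) (by omega)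
        rw [if_pos hu1]
        omega
      · rw [if_neg hu1]
        by_cases hg : Grows m ℓ pr t C ⟨t % ℓ, k, u⟩
        · have h4 := h3 hg.2.2
          have h5 := mt h2.2 hg.1
          rw [if_pos hg] at h1
          rw [if_pos (by omega)]
          omega
        · rw [if_neg hg] at h1
          omega
    · rw [if_neg hlt]
      rw [if_neg fun hg : Grows m ℓ pr t C ⟨t % ℓ, k, u⟩ => by have := h3 hg.2.2; omega] at h1
      simpa using h1
  have hsum := Finset.sum_le_sum hpt
  rw [Finset.sum_add_distrib, Finset.sum_add_distrib, Finset.sum_ite_eq', Finset.sum_ite_eq']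
    at hsum
  simp only [Finset.mem_Icc] at hsum
  have hv1 := hact v hlv le_rfl
  constructor
  · split_ifs at hsum <;> omega
  · intro hq
    have := hv1.1 hq
    rw [if_pos (by omega), if_pos (by omega), if_neg (by omega)] at hsum
    omega

theorem levelBadness_next_top (hm : 0 < m) (hℓ : 0 < ℓ) (hn : n = m ^ ℓ) (hC : Proper C)
    {v : ℕ} (hv : v < n) :
    levelBadness m ℓ (next m ℓ pr t C) (t % ℓ) v ≤ levelBadness m ℓ C (t % ℓ) v :=
  Finset.sum_le_sum fun _ hk => (badness_next_top hm hℓ hn hC hv hk).1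

theorem levelBadness_next_of_onTop (hm : 0 < m) (hℓ : 0 < ℓ) (hn : n = m ^ ℓ) (hC : Proper C)
    {v : ℕ} (hv : v < n) (htop : OnTop m ℓ pr t C v) :
    levelBadness m ℓ (next m ℓ pr t C) (t % ℓ) v + 1 ≤ levelBadness m ℓ C (t % ℓ) v := by
  obtain ⟨⟨j, k, u⟩, hq, hj, hu⟩ := htop
  simp only at hj hu
  subst hj hu
  have hk := mem_indices.2 (mem_active_bounds hm hq)
  exact Nat.succ_le_of_lt (Finset.sum_lt_sum
    (fun _ hk => (badness_next_top hm hℓ hn hC hv hk).1)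
    ⟨k, hk, (badness_next_top hm hℓ hn hC hv hk).2 hq⟩)

theorem onTop_of_levelBadness_pos (hm : 0 < m) (hℓ : 0 < ℓ) (hn : n = m ^ ℓ)
    {v : ℕ} (hv : v < n) (hpos : 0 < levelBadness m ℓ C (t % ℓ) v) : OnTop m ℓ pr t C v := by
  have htl : t % ℓ < ℓ := Nat.mod_lt _ hℓ
  obtain ⟨k, hk, hpos⟩ := Finset.exists_ne_zero_of_sum_ne_zero hpos.ne'
  obtain ⟨u, hu, hpos⟩ := Finset.exists_ne_zero_of_sum_ne_zero hpos
  obtain ⟨hk, hvk⟩ := mem_indices.1 hk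
  rw [Finset.mem_Icc] at hu
  have hb : Bad m ℓ C ⟨t % ℓ, k, u⟩ := by
    unfold excess at hpos
    unfold Bad
    omega
  obtain ⟨q, hq, hqv⟩ := exists_mem_formPaths hm hk hu.1 hu.2 hvk hb
  have hl := (mem_formPaths hm hq).1
  refine ⟨q, (mem_active_top hm hl).2 ⟨_, ?_, hq⟩, hl, hqv⟩
  rw [Nat.div_lt_iff_lt_mul (pow_pos hm _), ← pow_add,
    show ℓ - 1 - t % ℓ + (t % ℓ + 1) = ℓ by omega, ← hn]
  exact hv

theorem sum_levelBadness_next_le (hm : 0 < m) (hℓ : 0 < ℓ) (hn : n = m ^ ℓ) (hC : Proper C)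
    {v : ℕ} (hv : v < n) (j : ℕ) [Decidable (OnTop m ℓ pr t C v)] :
    ∑ i ∈ Finset.Ico j (t % ℓ), levelBadness m ℓ (next m ℓ pr t C) i v ≤
      ∑ i ∈ Finset.Ico j (t % ℓ), levelBadness m ℓ C i v +
        if OnTop m ℓ pr t C v then 1 else 0 := by
  classical
  unfold levelBadness badness
  -- With one flat sum, the total increase is the number of growing pseudo-buffers.
  simp_rw [Finset.sum_sigma']
  refine (Finset.sum_le_sum fun x _ => excess_next_le (pr := pr) (t := t) hm hℓ _).trans ?_
  rw [Finset.sum_add_distrib, ← Finset.card_filter]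
  refine Nat.add_le_add_left ?_ _
  have hbd : ∀ x ∈ ((Finset.Ico j (t % ℓ)).sigma fun i => (indices m i v).sigma fun _ =>
      Finset.Icc (left m i (v / m ^ (i + 1))) v).filter
        (fun x => Grows m ℓ pr t C ⟨x.1, x.2.1, x.2.2⟩), x.1 < t % ℓ ∧
        left m x.1 (v / m ^ (x.1 + 1)) ≤ x.2.2 ∧ x.2.2 ≤ v ∧
        Grows m ℓ pr t C ⟨x.1, x.2.1, x.2.2⟩ := by
    intro x hx
    simp only [Finset.mem_filter, Finset.mem_sigma, Finset.mem_Ico, Finset.mem_Icc] at hx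
    exact ⟨hx.1.1.2, hx.1.2.2.1, hx.1.2.2.2, hx.2⟩
  split_ifs with htop
  · rw [Finset.card_le_one]
    intro x hx y hy
    obtain ⟨h1, h2, h3, h4⟩ := hbd x hx
    obtain ⟨h1', h2', h3', h4'⟩ := hbd y hy
    have := Grows.unique hm hℓ hn hC hv h1 h1' h2 h3 h2' h3' h4 h4'
    obtain ⟨a, b, c⟩ := x
    obtain ⟨a', b', c'⟩ := y
    simp only [PB.mk.injEq] at this
    obtain ⟨rfl, rfl, rfl⟩ := this
    rfl
  · rw [Nat.le_zero, Finset.card_eq_zero, Finset.eq_empty_iff_forall_notMem]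
    intro x hx
    obtain ⟨h1, h2, h3, h4⟩ := hbd x hx
    exact htop ((h4.onTop hm hℓ hn hC h1 (lt_of_le_of_lt h3 hv)).extend hm h1 h2 h3 le_rfl)

theorem upperBadness_eq {j : ℕ} (hj : j < ℓ) (C : Config n) (v : ℕ) :
    upperBadness m ℓ C j v = levelBadness m ℓ C j v + upperBadness m ℓ C (j + 1) v :=
  Finset.sum_eq_sum_Ico_succ_bot hj _

theorem upperBadness_next_le (hm : 0 < m) (hℓ : 0 < ℓ) (hn : n = m ^ ℓ) (hC : Proper C)
    {v : ℕ} (hv : v < n) (j : ℕ) :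
    upperBadness m ℓ (next m ℓ pr t C) j v ≤ upperBadness m ℓ C j v := by
  classical
  have htl : t % ℓ < ℓ := Nat.mod_lt _ hℓ
  have hup : ∀ d, t % ℓ < d → upperBadness m ℓ (next m ℓ pr t C) d v ≤ upperBadness m ℓ C d v := by
    intro d hd
    refine Finset.sum_le_sum fun i hi => levelBadness_next_of_lt hm hℓ hn hC ?_ v
    rw [Finset.mem_Ico] at hi
    omega
  rcases lt_or_ge (t % ℓ) j with hj | hj
  · exact hup j hj
  · have hsplit : ∀ C : Config n, upperBadness m ℓ C j v =
        ∑ i ∈ Finset.Ico j (t % ℓ), levelBadness m ℓ C i v + upperBadness m ℓ C (t % ℓ) v :=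
      fun C => (Finset.sum_Ico_consecutive _ hj htl.le).symm
    rw [hsplit, hsplit, upperBadness_eq htl, upperBadness_eq htl]
    have h1 := sum_levelBadness_next_le (pr := pr) (t := t) hm hℓ hn hC hv j
    have h2 := hup _ (Nat.lt_succ_self (t % ℓ))
    have h3 := levelBadness_next_top (pr := pr) (t := t) hm hℓ hn hC hv
    split_ifs at h1 with htop
    · have h4 := levelBadness_next_of_onTop hm hℓ hn hC hv htop
      simp only [Nat.succ_eq_add_one] at h2
      omega
    · simp only [Nat.succ_eq_add_one] at h2
      omega

/-- Counting starts at the served level, so possible growth below it does not offset the drop. -/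
theorem upperBadness_next_lt (hm : 0 < m) (hℓ : 0 < ℓ) (hn : n = m ^ ℓ) (hC : Proper C)
    {v : ℕ} (hv : v < n) (hpos : 0 < levelBadness m ℓ C (t % ℓ) v) :
    upperBadness m ℓ (next m ℓ pr t C) (t % ℓ) v + 1 ≤ upperBadness m ℓ C (t % ℓ) v := by
  have htl : t % ℓ < ℓ := Nat.mod_lt _ hℓ
  have h1 := levelBadness_next_of_onTop hm hℓ hn hC hv
    (onTop_of_levelBadness_pos (pr := pr) hm hℓ hn hv hpos)
  have h2 : upperBadness m ℓ (next m ℓ pr t C) (t % ℓ + 1) v ≤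
      upperBadness m ℓ C (t % ℓ + 1) v := by
    refine Finset.sum_le_sum fun i hi => levelBadness_next_of_lt hm hℓ hn hC ?_ v
    rw [Finset.mem_Ico] at hi
    omega
  rw [upperBadness_eq htl, upperBadness_eq htl]
  omega

end Round

/-! ### Counting packets by pseudo-buffer -/

theorem mul_add_mod_of_lt {T c : ℕ} (h : c < ℓ) : (T * ℓ + c) % ℓ = c := by
  rw [Nat.add_comm, Nat.add_mul_mod_self_right, Nat.mod_eq_of_lt h]

theorem sum_card_filter_eq {α β : Type*} [DecidableEq β] (f : α → β) (s : Finset β)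
    (M : Multiset α) :
    ∑ x ∈ s, (M.filter (fun a => f a = x)).card = (M.filter (fun a => f a ∈ s)).card := by
  induction M using Multiset.induction with
  | empty => simp
  | cons a M ih =>
    simp only [← Multiset.countP_eq_card_filter, Multiset.countP_cons] at ih ⊢
    rw [Finset.sum_add_distrib, ih, Finset.sum_ite_eq]

theorem sum_card_filter_le {α β : Type*} [DecidableEq β] (f : α → β) (s : Finset β)
    (M : Multiset α) : ∑ x ∈ s, (M.filter (fun a => f a = x)).card ≤ M.card :=
  (sum_card_filter_eq f s M).le.trans (Multiset.card_le_card (Multiset.filter_le _ _))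

theorem card_filter_sum {α ι : Type*} (p : α → Prop) [DecidablePred p] (s : Finset ι)
    (M : ι → Multiset α) :
    ((∑ i ∈ s, M i).filter p).card = ∑ i ∈ s, ((M i).filter p).card := by
  simp only [← Multiset.countP_eq_card_filter]
  exact map_sum (Multiset.countPAddMonoidHom p) M s

/-- The packets of `C` at the nodes `u ≤ v` that still have to cross `v`. -/
def backlog (C : Config n) (v : ℕ) : ℕ :=
  ∑ u ∈ Finset.range (v + 1), ((C u).filter (fun P => v < P.dst)).card

theorem card_content_of_proper (hm : 0 < m) (hn : n = m ^ ℓ) {C : Config n} (hC : Proper C)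
    (j k u : ℕ) : (content m ℓ C ⟨j, k, u⟩).card = ((C u).filter (fun P =>
      (lv m ℓ u P.dst, digit m P.dst (lv m ℓ u P.dst)) = (j, k))).card := by
  classical
  rw [content_eq_filter]
  exact congrArg _ (Multiset.filter_congr fun P hP => belongs_iff (q := ⟨j, k, u⟩) hm hn (hC u P hP))

/-- Each new packet lies in one pseudo-buffer at its node, and is counted only if its intermediate
destination, hence its destination, lies beyond v. -/
theorem upperBadness_add_le (hm : 0 < m) (hn : n = m ^ ℓ) (C : Config n) {W : Config n}
    (hW : Proper W) (j v : ℕ) :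
    upperBadness m ℓ (fun i => C i + W i) j v ≤ upperBadness m ℓ C j v + backlog W v := by
  classical
  have h1 : ∀ q, excess m ℓ (fun i => C i + W i) q ≤
      excess m ℓ C q + (content m ℓ W q).card := by
    intro q
    unfold excess
    rw [content_eq_filter, content_eq_filter, content_eq_filter, Multiset.filter_add,
      Multiset.card_add]
    omega
  have h2 : ∀ i k, k ∈ indices m i v → ∀ u ∈ Finset.Icc (left m i (v / m ^ (i + 1))) v,
      (content m ℓ W ⟨i, k, u⟩).card = (((W u).filter (fun P => v < P.dst)).filter (fun P =>
        (lv m ℓ u P.dst, digit m P.dst (lv m ℓ u P.dst)) = (i, k))).card := by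
    intro i k hk u hu
    rw [Finset.mem_Icc] at hu
    rw [card_content_of_proper hm hn hW, Multiset.filter_filter]
    refine congrArg _ (Multiset.filter_congr fun P hP => ?_)
    have hud := hW u P hP
    refine ⟨fun h => ⟨h, ?_⟩, And.left⟩
    have hb := ((belongs_iff (q := ⟨i, k, u⟩) hm hn hud).2 h).2
    simp only at hb
    rw [div_eq_of_mem hu.1 (lt_of_le_of_lt hu.2 (lt_left_succ hm i v))] at hb
    exact (mem_indices.1 hk).2.trans_le (hb ▸ interDest_le m ℓ u P.dst)
  have h3 : ∀ i, ∑ k ∈ indices m i v, ∑ u ∈ Finset.Icc (left m i (v / m ^ (i + 1))) v,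
      (content m ℓ W ⟨i, k, u⟩).card ≤ ∑ k ∈ Finset.range m, ∑ u ∈ Finset.range (v + 1),
        (((W u).filter (fun P => v < P.dst)).filter (fun P =>
          (lv m ℓ u P.dst, digit m P.dst (lv m ℓ u P.dst)) = (i, k))).card := by
    intro i
    refine (Finset.sum_le_sum fun k hk => ?_).trans
      (Finset.sum_le_sum_of_subset (Finset.filter_subset _ _))
    rw [Finset.sum_congr rfl (h2 i k hk)]
    refine Finset.sum_le_sum_of_subset fun u hu => ?_
    rw [Finset.mem_Icc] at hu
    exact Finset.mem_range.2 (by omega)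
  have h4 : ∑ i ∈ Finset.Ico j ℓ, ∑ k ∈ indices m i v,
      ∑ u ∈ Finset.Icc (left m i (v / m ^ (i + 1))) v, (content m ℓ W ⟨i, k, u⟩).card ≤
        backlog W v := by
    refine (Finset.sum_le_sum fun i _ => h3 i).trans ?_
    rw [← Finset.sum_product', Finset.sum_comm]
    exact Finset.sum_le_sum fun u _ => sum_card_filter_le _ _ _
  refine le_trans ?_ (Nat.add_le_add_left h4 _)
  unfold upperBadness levelBadness badness
  simp only [← Finset.sum_add_distrib]
  exact Finset.sum_le_sum fun i _ => Finset.sum_le_sum fun k _ => Finset.sum_le_sum fun u _ => h1 _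

theorem card_le_of_proper (hm : 0 < m) (hn : n = m ^ ℓ) {C : Config n} (hC : Proper C) (i : ℕ) :
    (C i).card ≤ ℓ * (m - 1) + upperBadness m ℓ C 0 i := by
  classical
  have h1 : (C i).card = ∑ j ∈ Finset.range ℓ, ∑ k ∈ Finset.range m,
      (content m ℓ C ⟨j, k, i⟩).card := by
    simp only [card_content_of_proper hm hn hC]
    rw [← Finset.sum_product', sum_card_filter_eq, Multiset.filter_eq_self.2]
    intro P hP
    rw [Finset.mem_product, Finset.mem_range, Finset.mem_range]
    exact ⟨(lv_spec (hC i P hP) (hn ▸ P.dst_lt)).1, digit_lt hm _ _⟩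
  have h2 : ∀ j, ∑ k ∈ Finset.range m, (content m ℓ C ⟨j, k, i⟩).card ≤
      (m - 1) + levelBadness m ℓ C j i := by
    intro j
    have h3 : ∑ k ∈ Finset.range m, (content m ℓ C ⟨j, k, i⟩).card =
        ∑ k ∈ indices m j i, (content m ℓ C ⟨j, k, i⟩).card := by
      refine (Finset.sum_subset (Finset.filter_subset _ _) fun k _ hk => ?_).symm
      rw [Multiset.card_eq_zero, Multiset.eq_zero_iff_forall_notMem]
      intro P hP
      obtain ⟨hP, hb⟩ := mem_content.1 hP
      exact hk (mem_indices.2 (hb.idx_lt hm hn (hC i P hP)))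
    have h4 : (indices m j i).card ≤ m - 1 := by
      -- Index 0 is excluded: its destination is the left endpoint of the interval, which is not
      -- beyond i.
      have h5 : indices m j i ⊆ (Finset.range m).erase 0 := by
        intro k hk
        obtain ⟨h5, h6⟩ := mem_indices.1 hk
        refine Finset.mem_erase.2 ⟨?_, Finset.mem_range.2 h5⟩
        rintro rfl
        have := left_le m j i
        unfold dest at h6
        omega
      refine (Finset.card_le_card h5).trans ?_
      rw [Finset.card_erase_of_mem (Finset.mem_range.2 hm), Finset.card_range]
    rw [h3]
    refine le_trans ?_ (Nat.add_le_add_right h4 _)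
    rw [Finset.card_eq_sum_ones]
    unfold levelBadness
    rw [← Finset.sum_add_distrib]
    refine Finset.sum_le_sum fun k _ => ?_
    have h5 : excess m ℓ C ⟨j, k, i⟩ ≤ badness m ℓ C j k i :=
      Finset.single_le_sum (f := fun u => excess m ℓ C ⟨j, k, u⟩) (fun _ _ => Nat.zero_le _)
        (Finset.mem_Icc.2 ⟨left_le m j i, le_rfl⟩)
    unfold excess at h5
    omega
  rw [h1]
  refine (Finset.sum_le_sum fun j _ => h2 j).trans (le_of_eq ?_)
  rw [Finset.sum_add_distrib, Finset.sum_const, Finset.card_range, smul_eq_mul]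
  unfold upperBadness
  rw [Finset.range_eq_Ico]

/-! ### Executions and phases of ℓ rounds -/

section Execution

variable {pr : Priority n} {A : Adversary n}

theorem proper_arrivals (t : ℕ) : Proper (arrivals A t) := by
  intro i P hP
  unfold arrivals at hP
  rw [Multiset.mem_filter] at hP
  have := P.src_le_dst
  omega

theorem Proper.add {C W : Config n} (hC : Proper C) (hW : Proper W) :
    Proper (fun i => C i + W i) := by
  intro i P hP
  exact (Multiset.mem_add.1 hP).elim (hC i P) (hW i P)

theorem Proper.next (hm : 0 < m) (hℓ : 0 < ℓ) {C : Config n} (hC : Proper C) (t : ℕ) :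
    Proper (next m ℓ pr t C) := by
  classical
  intro i P hP
  unfold HPTS.next at hP
  rcases Multiset.mem_add.1 hP with hP | hP
  · exact hC i P (Multiset.mem_of_le tsub_le_self hP)
  · unfold arriving at hP
    split_ifs at hP with h0
    · simp at hP
    · rw [Multiset.mem_filter] at hP
      obtain ⟨q, -, hq, hqP⟩ := exists_of_mem_sent hm hℓ hP.1
      have := hC _ _ (mem_content.1 (mem_content_of_mem_head hqP)).1
      omega

theorem start_succ_waiting (t : ℕ) :
    (start m ℓ pr A (t + 1)).waiting = (state m ℓ pr A t).waiting := rfl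

theorem start_succ_stored (t : ℕ) :
    (start m ℓ pr A (t + 1)).stored = next m ℓ pr t (state m ℓ pr A t).stored := rfl

theorem state_of_mod_eq_zero {t : ℕ} (h : t % ℓ = 0) : state m ℓ pr A t =
    ⟨arrivals A t, fun i => (start m ℓ pr A t).stored i + (start m ℓ pr A t).waiting i⟩ :=
  if_pos h

theorem state_of_mod_ne_zero {t : ℕ} (h : t % ℓ ≠ 0) : state m ℓ pr A t =
    ⟨fun i => (start m ℓ pr A t).waiting i + arrivals A t i, (start m ℓ pr A t).stored⟩ :=
  if_neg h

theorem proper_state (hm : 0 < m) (hℓ : 0 < ℓ) (t : ℕ) :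
    Proper (state m ℓ pr A t).waiting ∧ Proper (state m ℓ pr A t).stored := by
  have key : ∀ t, Proper (start m ℓ pr A t).waiting → Proper (start m ℓ pr A t).stored →
      Proper (state m ℓ pr A t).waiting ∧ Proper (state m ℓ pr A t).stored := by
    intro t h1 h2
    by_cases h : t % ℓ = 0
    · rw [state_of_mod_eq_zero h]
      exact ⟨proper_arrivals t, h2.add h1⟩
    · rw [state_of_mod_ne_zero h]
      exact ⟨h1.add (proper_arrivals t), h2⟩
  induction t with
  | zero =>
    exact key 0 (fun _ _ h => absurd h (Multiset.notMem_zero _))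
      fun _ _ h => absurd h (Multiset.notMem_zero _)
  | succ t ih => exact key (t + 1) ih.1 (ih.2.next hm hℓ t)

theorem state_waiting (t i : ℕ) : (state m ℓ pr A t).waiting i =
    ∑ s ∈ Finset.Icc (t - t % ℓ) t, arrivals A s i := by
  induction t with
  | zero =>
    rw [state_of_mod_eq_zero (Nat.zero_mod ℓ)]
    simp
  | succ t ih =>
    by_cases h : (t + 1) % ℓ = 0
    · rw [state_of_mod_eq_zero h, h]
      simp
    · rw [state_of_mod_ne_zero h, start_succ_waiting]
      simp only
      have hmod : (t + 1) % ℓ = t % ℓ + 1 := by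
        rcases Nat.eq_zero_or_pos ℓ with rfl | hℓ
        · simp
        · rw [Nat.add_mod_eq_ite] at h ⊢
          rcases Nat.lt_or_ge 1 ℓ with h1 | h1
          · rw [Nat.mod_eq_of_lt h1] at h ⊢
            have := Nat.mod_lt t hℓ
            split_ifs at h ⊢ <;> omega
          · obtain rfl : ℓ = 1 := by omega
            simp [Nat.mod_one] at h
      rw [ih, hmod, Nat.add_sub_add_right, Finset.sum_Icc_succ_top]
      have := Nat.sub_le t (t % ℓ)
      omega

theorem backlog_state_waiting_le (t v : ℕ) :
    backlog (state m ℓ pr A t).waiting v ≤ A.crossings (t - t % ℓ) t v := by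
  classical
  unfold backlog Adversary.crossings
  simp only [state_waiting, card_filter_sum]
  rw [Finset.sum_comm]
  refine Finset.sum_le_sum fun s _ => ?_
  refine le_trans (Finset.sum_le_sum fun u hu => ?_)
    (sum_card_filter_le Packet.src (Finset.range (v + 1)) _)
  rw [Finset.mem_range] at hu
  unfold arrivals
  rw [Multiset.filter_filter, Multiset.filter_filter]
  refine Multiset.card_le_card (Multiset.monotone_filter_right _ ?_)
  rintro P ⟨h1, h2, -⟩
  exact ⟨h2, by omega, h1.le⟩

theorem card_waiting_le (hm : 0 < m) (hℓ : 0 < ℓ) (t v : ℕ) :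
    ((state m ℓ pr A t).waiting v).card ≤ A.crossings (t - t % ℓ) t v := by
  refine le_trans ?_ (backlog_state_waiting_le (m := m) (pr := pr) t v)
  have h := (proper_state (pr := pr) (A := A) hm hℓ t).1 v
  conv_lhs => rw [← Multiset.filter_eq_self.2 h]
  exact Finset.single_le_sum
    (f := fun u => (((state m ℓ pr A t).waiting u).filter (fun P => v < P.dst)).card)
    (fun _ _ => Nat.zero_le _) (Finset.self_mem_range_succ v)

theorem upperBadness_start_succ_le (hm : 0 < m) (hℓ : 0 < ℓ) (hn : n = m ^ ℓ) {v : ℕ}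
    (hv : v < n) (j t : ℕ) : upperBadness m ℓ (start m ℓ pr A (t + 1)).stored j v ≤
      upperBadness m ℓ (state m ℓ pr A t).stored j v :=
  upperBadness_next_le hm hℓ hn (proper_state hm hℓ t).2 hv j

theorem upperBadness_state_le (hm : 0 < m) (hℓ : 0 < ℓ) (hn : n = m ^ ℓ) {v : ℕ}
    (hv : v < n) (j T : ℕ) {d c : ℕ} (hdc : d ≤ c) (hc : c < ℓ) :
    upperBadness m ℓ (state m ℓ pr A (T * ℓ + c)).stored j v ≤
      upperBadness m ℓ (state m ℓ pr A (T * ℓ + d)).stored j v := by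
  induction c, hdc using Nat.le_induction with
  | base => exact le_rfl
  | succ c _ ih =>
    refine le_trans ?_ (ih (by omega))
    have hne : (T * ℓ + (c + 1)) % ℓ ≠ 0 := by
      rw [mul_add_mod_of_lt hc]
      omega
    rw [state_of_mod_ne_zero hne]
    exact upperBadness_start_succ_le hm hℓ hn hv j _

/-- Level j has its turn in round T * ℓ + j. Either a bad packet of level j then crosses v and the
potential drops, or there is none and only levels from j + 1 on contribute. The other rounds of the
phase do no harm. -/
theorem upperBadness_phase_le (hm : 0 < m) (hℓ : 0 < ℓ) (hn : n = m ^ ℓ) {v : ℕ}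
    (hv : v < n) (T : ℕ) {j : ℕ} (hj : j < ℓ) :
    upperBadness m ℓ (start m ℓ pr A ((T + 1) * ℓ)).stored j v ≤
      max (upperBadness m ℓ (state m ℓ pr A (T * ℓ)).stored j v - 1)
        (upperBadness m ℓ (state m ℓ pr A (T * ℓ)).stored (j + 1) v) := by
  have h1 : upperBadness m ℓ (start m ℓ pr A ((T + 1) * ℓ)).stored j v ≤
      upperBadness m ℓ (start m ℓ pr A (T * ℓ + j + 1)).stored j v := by
    rcases (Nat.succ_le_of_lt hj).eq_or_lt with h | h
    · rw [show (T + 1) * ℓ = T * ℓ + j + 1 by rw [Nat.add_mul]; omega]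
    · have hne : (T * ℓ + (j + 1)) % ℓ ≠ 0 := by
        rw [mul_add_mod_of_lt h]
        omega
      have h2 := upperBadness_state_le (pr := pr) (A := A) hm hℓ hn hv j T
        (Nat.le_sub_one_of_lt h) (Nat.sub_lt hℓ Nat.one_pos)
      rw [Nat.succ_eq_add_one, state_of_mod_ne_zero hne] at h2
      refine le_trans ?_ h2
      rw [show (T + 1) * ℓ = T * ℓ + (ℓ - 1) + 1 by rw [Nat.add_mul]; omega]
      exact upperBadness_start_succ_le hm hℓ hn hv j _
  refine h1.trans ?_
  have hmod : (T * ℓ + j) % ℓ = j := mul_add_mod_of_lt hj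
  have hC := (proper_state (pr := pr) (A := A) hm hℓ (T * ℓ + j)).2
  have h2 := fun i => upperBadness_state_le (pr := pr) (A := A) hm hℓ hn hv i T
    (Nat.zero_le j) hj
  rw [start_succ_stored]
  rcases Nat.eq_zero_or_pos (levelBadness m ℓ (state m ℓ pr A (T * ℓ + j)).stored j v) with h | h
  · refine le_max_of_le_right (le_trans ?_ (h2 (j + 1)))
    refine (upperBadness_next_le hm hℓ hn hC hv j).trans (le_of_eq ?_)
    rw [upperBadness_eq hj, h, zero_add]
  · have h3 := upperBadness_next_lt (pr := pr) (t := T * ℓ + j) hm hℓ hn hC hv (by rwa [hmod])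
    rw [hmod] at h3
    have h4 := h2 j
    rw [add_zero] at h4
    exact le_max_of_le_left (by omega)

/-! ### Comparison with a queue, and the final bound -/

/-- The bound on the number of bad packets that cross `v` after the acceptance of packets in
round `T * ℓ`: the backlog of a queue that serves one packet per phase. -/
def phaseBound (A : Adversary n) (ℓ v : ℕ) : ℕ → ℕ
  | 0 => 0
  | T + 1 => phaseBound A ℓ v T - 1 + A.crossings (T * ℓ) ((T + 1) * ℓ - 1) v

theorem upperBadness_accept_le (hm : 0 < m) (hℓ : 0 < ℓ) (hn : n = m ^ ℓ) (j T v : ℕ) :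
    upperBadness m ℓ (state m ℓ pr A ((T + 1) * ℓ)).stored j v ≤
      upperBadness m ℓ (start m ℓ pr A ((T + 1) * ℓ)).stored j v +
        A.crossings (T * ℓ) ((T + 1) * ℓ - 1) v := by
  have he : (T + 1) * ℓ = T * ℓ + (ℓ - 1) + 1 := by rw [Nat.add_mul]; omega
  have hW : (start m ℓ pr A ((T + 1) * ℓ)).waiting =
      (state m ℓ pr A (T * ℓ + (ℓ - 1))).waiting := by
    rw [he]
    rfl
  rw [state_of_mod_eq_zero (Nat.mul_mod_left _ _)]
  refine (upperBadness_add_le hm hn _ ?_ j v).trans (Nat.add_le_add_left ?_ _)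
  · rw [hW]
    exact (proper_state hm hℓ _).1
  · rw [hW]
    refine (backlog_state_waiting_le _ v).trans (le_of_eq ?_)
    rw [mul_add_mod_of_lt (Nat.sub_lt hℓ Nat.one_pos), Nat.add_sub_cancel, he,
      Nat.add_sub_cancel]

theorem upperBadness_zero (j v : ℕ) :
    upperBadness m ℓ (state m ℓ pr A 0).stored j v = 0 := by
  rw [state_of_mod_eq_zero (Nat.zero_mod ℓ)]
  unfold upperBadness levelBadness badness excess content start
  simp

/-- The slack ℓ - 1 - j shrinks by one from j to j + 1, which makes up for the missing service when
the second term of the maximum in `upperBadness_phase_le` applies. -/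
theorem upperBadness_le_phaseBound (hm : 0 < m) (hℓ : 0 < ℓ) (hn : n = m ^ ℓ) {v : ℕ}
    (hv : v < n) (T : ℕ) : ∀ j < ℓ, upperBadness m ℓ (state m ℓ pr A (T * ℓ)).stored j v ≤
      phaseBound A ℓ v T + (ℓ - 1 - j) := by
  induction T with
  | zero =>
    intro j _
    rw [zero_mul, upperBadness_zero]
    exact Nat.zero_le _
  | succ T ih =>
    intro j hj
    refine (upperBadness_accept_le hm hℓ hn j T v).trans ?_
    have h1 := upperBadness_phase_le (pr := pr) (A := A) hm hℓ hn hv T hj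
    have h2 := ih j hj
    have h3 : upperBadness m ℓ (state m ℓ pr A (T * ℓ)).stored (j + 1) v ≤
        phaseBound A ℓ v T - 1 + (ℓ - 1 - j) := by
      rcases (Nat.succ_le_of_lt hj).eq_or_lt with h | h
      · rw [upperBadness, Finset.Ico_eq_empty (by omega), Finset.sum_empty]
        exact Nat.zero_le _
      · have := ih (j + 1) h
        omega
    unfold phaseBound
    omega

theorem crossings_add {a b c v : ℕ} (hab : a ≤ b) (hbc : b ≤ c) (hb : 0 < b) :
    A.crossings a (b - 1) v + A.crossings b c v = A.crossings a c v := by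
  unfold Adversary.crossings
  rw [← Finset.Ico_add_one_right_eq_Icc, ← Finset.Ico_add_one_right_eq_Icc,
    ← Finset.Ico_add_one_right_eq_Icc, show b - 1 + 1 = b by omega]
  exact Finset.sum_Ico_consecutive _ hab (by omega)

/-- S is the last phase that the queue enters empty; from then on it serves one packet in each of
the T - 1 - S later phases. -/
theorem phaseBound_le (hℓ : 0 < ℓ) (v T : ℕ) : phaseBound A ℓ v T = 0 ∨
    ∃ S < T, phaseBound A ℓ v T + (T - 1 - S) ≤ A.crossings (S * ℓ) (T * ℓ - 1) v := by
  induction T with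
  | zero => exact Or.inl rfl
  | succ T ih =>
    right
    rcases Nat.eq_zero_or_pos (phaseBound A ℓ v T) with h | h
    · refine ⟨T, Nat.lt_succ_self T, ?_⟩
      unfold phaseBound
      omega
    · obtain ⟨S, hS, h1⟩ := ih.resolve_left h.ne'
      refine ⟨S, by omega, ?_⟩
      have h2 : T * ℓ ≤ (T + 1) * ℓ - 1 := by
        rw [Nat.add_mul]
        omega
      rw [← crossings_add (Nat.mul_le_mul_right ℓ hS.le) h2 (Nat.mul_pos (by omega) hℓ)]
      unfold phaseBound
      omega

/-- The rounds lie in T + 1 - S phases, each of which adds at most ρℓ ≤ 1 to the bound. -/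
theorem crossings_le {ρ : ℝ} {σ : ℕ} (hρ : 0 ≤ ρ) (hρℓ : ρ * ℓ ≤ 1) (hA : A.IsBounded ρ σ)
    {v S T t : ℕ} (hv : v < n) (hST : S ≤ T) (hTt : T * ℓ ≤ t) (ht : t < (T + 1) * ℓ) :
    A.crossings (S * ℓ) t v ≤ T + 1 - S + σ := by
  have h1 := hA v hv (S * ℓ) t ((Nat.mul_le_mul_right ℓ hST).trans hTt)
  have h2 : ((t : ℝ) - (S * ℓ : ℕ) + 1) ≤ ((T + 1 - S : ℕ) : ℝ) * ℓ := by
    have h3 : (t : ℝ) + 1 ≤ ((T + 1) * ℓ : ℕ) := by exact_mod_cast ht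
    rw [Nat.cast_sub (by omega)]
    push_cast at h3 ⊢
    linarith
  have h4 : ρ * ((t : ℝ) - (S * ℓ : ℕ) + 1) ≤ ((T + 1 - S : ℕ) : ℝ) :=
    calc ρ * ((t : ℝ) - (S * ℓ : ℕ) + 1) ≤ ρ * (((T + 1 - S : ℕ) : ℝ) * ℓ) :=
          mul_le_mul_of_nonneg_left h2 hρ
      _ = ((T + 1 - S : ℕ) : ℝ) * (ρ * ℓ) := by ring
      _ ≤ ((T + 1 - S : ℕ) : ℝ) * 1 := mul_le_mul_of_nonneg_left hρℓ (Nat.cast_nonneg _)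
      _ = _ := mul_one _
  have h5 : (A.crossings (S * ℓ) t v : ℝ) ≤ ((T + 1 - S + σ : ℕ) : ℝ) := by
    push_cast at h1 h4 ⊢
    linarith
  exact_mod_cast h5

theorem load_le (hm : 0 < m) (hℓ : 0 < ℓ) (hn : n = m ^ ℓ) {ρ : ℝ} {σ : ℕ} (hρ : 0 ≤ ρ)
    (hρℓ : ρ * ℓ ≤ 1) (hA : A.IsBounded ρ σ) {v : ℕ} (hv : v < n) (t : ℕ) :
    (state m ℓ pr A t).load v ≤ ℓ * m + σ + 1 := by
  have hlt : t % ℓ < ℓ := Nat.mod_lt _ hℓ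
  have ht : t / ℓ * ℓ + t % ℓ = t := Nat.div_add_mod' t ℓ
  have h1 := card_le_of_proper hm hn (proper_state (pr := pr) (A := A) hm hℓ t).2 v
  have h2 := upperBadness_state_le (pr := pr) (A := A) hm hℓ hn hv 0 (t / ℓ) (Nat.zero_le _) hlt
  have h3 := upperBadness_le_phaseBound (pr := pr) (A := A) hm hℓ hn hv (t / ℓ) 0 hℓ
  have h4 := card_waiting_le (pr := pr) (A := A) hm hℓ t v
  rw [ht, add_zero] at h2
  rw [show t - t % ℓ = t / ℓ * ℓ by omega] at h4
  have hT1 : t / ℓ * ℓ ≤ t := by omega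
  have hT2 : t < (t / ℓ + 1) * ℓ := by
    rw [Nat.add_mul]
    omega
  -- The rounds from S * ℓ to t allow T + 1 - S + σ crossings, and T - 1 - S of these have been
  -- served. The remaining 2 stand for phase S, which has no service, and the current phase, still
  -- waiting.
  have h5 : phaseBound A ℓ v (t / ℓ) + A.crossings (t / ℓ * ℓ) t v ≤ σ + 2 := by
    rcases phaseBound_le (A := A) hℓ v (t / ℓ) with h | ⟨S, hS, h⟩
    · have := crossings_le hρ hρℓ hA hv le_rfl hT1 hT2
      omega
    · have h6 := crossings_le hρ hρℓ hA hv hS.le hT1 hT2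
      rw [← crossings_add (Nat.mul_le_mul_right ℓ hS.le) hT1 (Nat.mul_pos (by omega) hℓ)] at h6
      omega
  have h6 : ℓ * m = ℓ * (m - 1) + ℓ := by
    rw [← Nat.mul_succ]
    congr 1
    omega
  unfold State.load
  omega

end Execution

end HPTS

theorem mainTheorem1 (m ℓ n : ℕ) (hℓ : 0 < ℓ) (hn : n = m ^ ℓ)
    (ρ : ℝ) (hρ : 0 ≤ ρ) (hρℓ : ρ * ℓ ≤ 1) (σ : ℕ)
    (A : HPTS.Adversary n) (hA : A.IsBounded ρ σ) (pr : HPTS.Priority n) :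
    ∀ t : ℕ, ∀ i < n,
      (HPTS.sent m ℓ pr t (HPTS.state m ℓ pr A t).stored i).card ≤ 1 ∧
      (((HPTS.state m ℓ pr A t).load i : ℕ) : ℝ) ≤ ℓ * (n : ℝ) ^ ((1 : ℝ) / ℓ) + σ + 1 := by
  intro t i hi
  -- For m = 0 the path has no nodes, since ℓ > 0.
  have hm : 0 < m := by
    rcases Nat.eq_zero_or_pos m with rfl | h
    · rw [hn, zero_pow hℓ.ne'] at hi
      omega
    · exact h
  refine ⟨HPTS.card_sent_le hm hℓ i, ?_⟩
  have hroot : (n : ℝ) ^ ((1 : ℝ) / ℓ) = m := by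
    rw [hn, Nat.cast_pow, one_div]
    exact Real.pow_rpow_inv_natCast (Nat.cast_nonneg m) hℓ.ne'
  rw [hroot]
  exact_mod_cast HPTS.load_le hm hℓ hn hρ hρℓ hA hi t
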